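/- **Setting.** A network is a finite connected simple graph $(\mathcal N,\mathcal E)$ with at least three nodes; it is *weakly cyclic* if no edge belongs to more than one cycle. A *market* on it consists of demands $d_n\ge 0$ with total $D=\sum_n d_n>0$; a set $\mathcal N_g\subseteq\mathcal N$ of generators, $|\mathcal N_g|>2$; cost functions $c_n$ $(n\in\mathcal N_g)$ that are convex, strictly increasing and differentiable on $[0,\infty)$ with $c_n(0)=0$; capacity limits $\underline s_n\ge 0$, $\bar s_n$; flow limits $f_{nm}\ge 0$ and admittances $B_{nm}>0$ on the edges. It is assumed that $\sum_{m\in\mathcal N_g,m\ne n}\bar s_m>D$ for all $n\in\mathcal N_g$. A supply profile $(s_n)_{n\in\mathcal N_g}$ is *feasible* if $\sum_n s_n=D$, $\underline s_n\le s_n\le\bar s_n$, and the linearized (DC) power flow with injections $s_n-d_n$ (with $s_n:=0$ for $n\notin\mathcal N_g$) satisfies the flow limits; it is assumed that some profile satisfies all these inequalities strictly. A *social optimum* $s^*$ minimizes $\sum_n c_n(s_n)$ over feasible profiles. Suppliers choose $w_n\ge 0$; the price is $p(w)=\sum_{n\in\mathcal N_g} w_n/((|\mathcal N_g|-1)D)$,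 which must be positive, and supplier $n$ produces $S_n(w)=D-w_n/p(w)$ with profit $p(w)S_n(w)-c_n(S_n(w))$. A *supply function equilibrium* (SFE) is a $w$ such that, for each $n\in\mathcal N_g$, $w_n$ maximizes the profit of $n$ given $w_{-n}$, among the actions for which $\underline s_n\le S_n\le\bar s_n$ and the flow limits hold. The price of anarchy (PoA) is the ratio $\sum_n c_n(S_n(w))/\sum_n c_n(s^*_n)$ of the total cost at an SFE $w$ to that at a social optimum $s^*$; it is well defined if SFE and optima exist and all of them give the same ratio. For each node $n$ fix a partition $\mathcal P(n)$ of its set of neighbors $\mathcal N(n)$ into singletons and duples such that each duple consists of the two neighbors of $n$ on some cycle, and no two singletons lie on a common cycle; for each duple in $\mathcal P(n)$ fix such a cycle $C$. The effective flow limit is $\hat f_{nm}=f_{nm}$ if $\{m\}\in\mathcal P(n)$, and $\hat f_{nm}=\min\{f_{nm},\,B_{nm}\sum_{jk\in \mathcal E(C),\,jk\ne nm} f_{jk}/B_{jk}\}$ if $m$ is in a duple with cycle $C$. The upper bound on the PoA is $$\beta = 1+\max_{n\in\mathcal N_g}\frac{\min\{\bar s_n,\ D-\sum_{m\in\mathcal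 N_g,m\ne n}\underline s_m,\ d_n+\sum_{m\in\mathcal N(n)}\hat f_{nm}\}}{(|\mathcal N_g|-2)D}.$$ **Theorem.** For every weakly cyclic network, such partitions and cycles exist, and for every $\varepsilon>0$ there are demands, a set of generators, cost functions, capacity limits, flow limits and admittances forming a market as above, for which the PoA is well defined and, for every choice of the partitions and cycles, $$\beta = 1+\max_{n\in\mathcal N_g}\frac{d_n+\sum_{m\in\mathcal N(n)}\hat f_{nm}}{(|\mathcal N_g|-2)D}\qquad\text{and}\qquad |\mathrm{PoA}-\beta|\le\varepsilon .$$ -/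

import Mathlib

namespace PowerMarket

section Graph

variable {V : Type*} [Fintype V] [DecidableEq V]

/-- `C` is the set of edges of a cycle of `G`: a closed walk through at least three distinct nodes.
A cycle is identified with its edge set, so the starting node and the orientation do not matter. -/
def IsCycleSet (G : SimpleGraph V) (C : Finset (Sym2 V)) : Prop :=
  ∃ (u : V) (p : G.Walk u u), p.IsCycle ∧ p.edges.toFinset = C

/-- A weakly-cyclic network: no edge belongs to more than one cycle. -/
def IsWeaklyCyclic (G : SimpleGraph V) : Prop :=
  ∀ C C' : Finset (Sym2 V), IsCycleSet G C → IsCycleSet G C' → ∀ e ∈ C, e ∈ C' → C = C'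

/-- For every node `n`, a partition of the neighbors of `n` into singletons and duples, and
a choice of a cycle for each duple, such that the two members of a duple are the two neighbors of
`n` on the chosen cycle, and no two singletons lie on a common cycle. -/
structure NeighborPartition (G : SimpleGraph V) [DecidableRel G.Adj] where
  /-- the partition of the neighbors of `n` -/
  parts : ∀ n : V, Finpartition (G.neighborFinset n)
  /-- the cycle (as an edge set) chosen for a duple of the partition at `n` -/
  cyc : V → Finset V → Finset (Sym2 V)
  card_part : ∀ n, ∀ S ∈ (parts n).parts, S.card = 1 ∨ S.card = 2
  isCycleSet_cyc : ∀ n, ∀ S ∈ (parts n).parts, S.card = 2 → IsCycleSet G (cyc n S)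
  mem_cyc : ∀ n, ∀ S ∈ (parts n).parts, S.card = 2 → ∀ i ∈ S, s(n, i) ∈ cyc n S
  singletons : ∀ n i j, i ≠ j → {i} ∈ (parts n).parts → {j} ∈ (parts n).parts →
    ¬ ∃ C, IsCycleSet G C ∧ (∃ e ∈ C, i ∈ e) ∧ (∃ e ∈ C, j ∈ e)

end Graph

/-- The data of an electricity market on the node set `V`. Cost functions, capacity limits,
supplies and actions matter only at the generator nodes `gens`; flow limits and admittances matter
only at the edges of the network. -/
structure Market (V : Type*) where
  /-- inelastic demand -/
  d : V → ℝ
  /-- nodes with a generator -/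
  gens : Finset V
  /-- cost functions -/
  cost : V → ℝ → ℝ
  /-- lower capacity limits -/
  slo : V → ℝ
  /-- upper capacity limits -/
  shi : V → ℝ
  /-- flow limits of the lines -/
  f : Sym2 V → ℝ
  /-- admittances of the lines -/
  B : Sym2 V → ℝ

namespace Market

variable {V : Type*} [Fintype V] [DecidableEq V]

/-- Total demand. -/
def totalDemand (M : Market V) : ℝ := ∑ j, M.d j

/-- Net power injection at node `i` under the supply profile `s`. -/
def injection (M : Market V) (s : V → ℝ) (i : V) : ℝ :=
  (if i ∈ M.gens then s i else 0) - M.d i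

/-- `θ` are voltage angles of the linearized (DC) power flow for the supply profile `s`:
line `i j` carries `B i j * (θ i - θ j)` from `i` to `j`, and the net outflow of every node is its
injection. On a connected network with positive admittances and balanced injections, such `θ`
exist and are unique up to an additive constant, and the line flows they induce are the image of
the injections under the shift-factor matrix. -/
def IsAngle (G : SimpleGraph V) [DecidableRel G.Adj] (M : Market V) (s θ : V → ℝ) : Prop :=
  ∀ i, ∑ j ∈ G.neighborFinset i, M.B s(i, j) * (θ i - θ j) = M.injection s i

/-- The line flows under `s` respect the flow limits. -/
def FlowOK (G : SimpleGraph V) [DecidableRel G.Adj] (M : Market V) (s : V → ℝ) : Prop :=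
  ∃ θ, M.IsAngle G s θ ∧ ∀ i j, G.Adj i j → |M.B s(i, j) * (θ i - θ j)| ≤ M.f s(i, j)

/-- The line flows under `s` respect the flow limits strictly. -/
def FlowStrict (G : SimpleGraph V) [DecidableRel G.Adj] (M : Market V) (s : V → ℝ) : Prop :=
  ∃ θ, M.IsAngle G s θ ∧ ∀ i j, G.Adj i j → |M.B s(i, j) * (θ i - θ j)| < M.f s(i, j)

/-- The standing assumptions on a market over the network `G`. -/
structure IsAdmissible (G : SimpleGraph V) [DecidableRel G.Adj] (M : Market V) : Prop where
  demand_nonneg : ∀ n, 0 ≤ M.d n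
  totalDemand_pos : 0 < M.totalDemand
  two_lt_card : 2 < M.gens.card
  cost_zero : ∀ n ∈ M.gens, M.cost n 0 = 0
  cost_convex : ∀ n ∈ M.gens, ConvexOn ℝ (Set.Ici 0) (M.cost n)
  cost_strictMono : ∀ n ∈ M.gens, StrictMonoOn (M.cost n) (Set.Ici 0)
  cost_differentiable : ∀ n ∈ M.gens, DifferentiableOn ℝ (M.cost n) (Set.Ici 0)
  slo_nonneg : ∀ n ∈ M.gens, 0 ≤ M.slo n
  admittance_pos : ∀ e ∈ G.edgeSet, 0 < M.B e
  flowLimit_nonneg : ∀ e ∈ G.edgeSet, 0 ≤ M.f e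
  /-- every generator is dispensable -/
  dispensable : ∀ n ∈ M.gens, M.totalDemand < ∑ m ∈ M.gens.erase n, M.shi m
  /-- there is a strictly feasible supply profile -/
  strictly_feasible : ∃ s : V → ℝ, ∑ n ∈ M.gens, s n = M.totalDemand ∧
    (∀ n ∈ M.gens, M.slo n < s n ∧ s n < M.shi n) ∧ M.FlowStrict G s

/-- Feasible supply profiles of the economic dispatch problem. -/
def IsFeasible (G : SimpleGraph V) [DecidableRel G.Adj] (M : Market V) (s : V → ℝ) : Prop :=
  ∑ n ∈ M.gens, s n = M.totalDemand ∧ (∀ n ∈ M.gens, M.slo n ≤ s n ∧ s n ≤ M.shi n) ∧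
    M.FlowOK G s

/-- Total generation cost. -/
def totalCost (M : Market V) (s : V → ℝ) : ℝ := ∑ n ∈ M.gens, M.cost n (s n)

/-- Socially optimal supply profiles. -/
def IsSocialOptimum (G : SimpleGraph V) [DecidableRel G.Adj] (M : Market V) (s : V → ℝ) : Prop :=
  M.IsFeasible G s ∧ ∀ s', M.IsFeasible G s' → M.totalCost s ≤ M.totalCost s'

/-- The market clearing price at the action profile `w`. -/
noncomputable def price (M : Market V) (w : V → ℝ) : ℝ :=
  (∑ n ∈ M.gens, w n) / (((M.gens.card : ℝ) - 1) * M.totalDemand)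

/-- The supply profile at the action profile `w`: supplier `n` bids the supply function
`p ↦ D - w n / p`, evaluated at the market clearing price. -/
noncomputable def supply (M : Market V) (w : V → ℝ) (n : V) : ℝ :=
  M.totalDemand - w n / M.price w

/-- Profit of supplier `n` at the action profile `w`. -/
noncomputable def profit (M : Market V) (w : V → ℝ) (n : V) : ℝ :=
  M.price w * M.supply w n - M.cost n (M.supply w n)

/-- `w n` is a feasible action of supplier `n` given the actions of the others: it is nonnegative,
the market clears (which needs a positive price), and the resulting supply of `n` and the
resulting line flows respect their limits. -/
def ActionFeasible (G : SimpleGraph V) [DecidableRel G.Adj] (M : Market V) (w : V → ℝ) (n : V) :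
    Prop :=
  0 ≤ w n ∧ 0 < M.price w ∧ (M.slo n ≤ M.supply w n ∧ M.supply w n ≤ M.shi n) ∧
    M.FlowOK G (M.supply w)

/-- Supply function equilibrium: every supplier's action maximizes its profit over its feasible
actions, given the actions of the others (a generalized Nash equilibrium). -/
def IsSFE (G : SimpleGraph V) [DecidableRel G.Adj] (M : Market V) (w : V → ℝ) : Prop :=
  ∀ n ∈ M.gens, M.ActionFeasible G w n ∧
    ∀ x : ℝ, M.ActionFeasible G (Function.update w n x) n →
      M.profit (Function.update w n x) n ≤ M.profit w n

/-- `ρ` is the price of anarchy: equilibria and social optima exist, and the ratio of the total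
cost at equilibrium to the total cost at social optimum is `ρ`, whichever equilibrium and optimum
are taken. -/
def IsPoA (G : SimpleGraph V) [DecidableRel G.Adj] (M : Market V) (ρ : ℝ) : Prop :=
  (∃ w, M.IsSFE G w) ∧ (∃ s, M.IsSocialOptimum G s) ∧
    ∀ w s, M.IsSFE G w → M.IsSocialOptimum G s →
      M.totalCost (M.supply w) / M.totalCost s = ρ

/-- Effective flow limit from node `n` to its neighbor `m`. -/
noncomputable def effFlow {G : SimpleGraph V} [DecidableRel G.Adj] (M : Market V)
    (P : NeighborPartition G) (n m : V) : ℝ :=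
  if (P.parts n).part m = {m} then M.f s(n, m)
  else min (M.f s(n, m))
    ((∑ e ∈ (P.cyc n ((P.parts n).part m)).erase s(n, m), M.f e / M.B e) * M.B s(n, m))

/-- The network term of supplier `n`: local demand plus effective flow limits of its lines. -/
noncomputable def networkTerm {G : SimpleGraph V} [DecidableRel G.Adj] (M : Market V)
    (P : NeighborPartition G) (n : V) : ℝ :=
  M.d n + ∑ m ∈ G.neighborFinset n, M.effFlow P n m

/-- The upper bound on the price of anarchy. -/
noncomputable def bound {G : SimpleGraph V} [DecidableRel G.Adj] (M : Market V)
    (P : NeighborPartition G) : ℝ :=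
  1 + ⨆ n : M.gens,
    min (M.shi n) (min (M.totalDemand - ∑ m ∈ M.gens.erase n, M.slo m) (M.networkTerm P n)) /
      (((M.gens.card : ℝ) - 2) * M.totalDemand)

/-- The upper bound with only its network component. -/
noncomputable def networkBound {G : SimpleGraph V} [DecidableRel G.Adj] (M : Market V)
    (P : NeighborPartition G) : ℝ :=
  1 + ⨆ n : M.gens, M.networkTerm P n / (((M.gens.card : ℝ) - 2) * M.totalDemand)

end Market

end PowerMarket

namespace PowerMarket

/-! Write N for the number of nodes, E = (N - 2) D, and A = D - (N - 1) σ - 1. Moving along its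
residual demand, a supplier producing s with cost c perceives the marginal cost c'(s) (1 + s / E). A
dominant supplier therefore inflates its marginal cost by nearly 1 + D / E and loses sales to rivals
whose true cost is higher by that factor; the bound is attained in the limit.

The market puts a cheap supplier at a non-cut node `v` holding almost all demand. Its first A units
cost only A / (k + 1), and later units cost 1 each; all others have the constant marginal cost γ =
`worstSlope` > 1. Lower limits A at `v` and σ elsewhere leave a single unit to allocate. The optimum
gives it to `v`, since γ > 1. In equilibrium the others get it: if `v` produced more than A, then E
+ S v ≤ p E ≤ γ (E + σ + 1) = E + A (`le_price_of_isSFE`, `price_le_of_isSFE`), a contradiction. So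
the cost ratio tends to γ as σ and A / (k + 1) vanish, and γ and the bound differ by O(N / D)
(`abs_poA_sub_bound_le`).

For the network term to be the active one, the lines at `v` have limit 1 and are saturated at the
optimum. The rivals' inequality then needs that their expansion relieves every line at `v`. Because
`v` is not a cut node and lines away from it have huge admittance, the rest of the network acts like
a single node, and the injection at `v` splits evenly (`abs_flow_sub_le`).

The partitions come from grouping the neighbors of n by the components left after removing n. -/

open Filter Topology

/-! ### Cycles through a node and the partition of its neighbors -/

section Cycles

variable {V : Type*} {G : SimpleGraph V}

/-- Two neighbors of `n` joined by a walk avoiding `n` are the neighbors of `n` on a cycle. -/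
theorem exists_isCycleSet_of_walk [DecidableEq V] {n i j : V} (hi : G.Adj n i) (hj : G.Adj n j)
    (hij : i ≠ j) (p : G.Walk i j) (hp : n ∉ p.support) :
    ∃ C, IsCycleSet G C ∧ s(n, i) ∈ C ∧ s(n, j) ∈ C := by
  have hq : n ∉ p.bypass.support := fun h => hp (p.support_bypass_subset_support h)
  refine ⟨_, ⟨n, .cons hi (p.bypass.concat hj.symm), ?_, rfl⟩, ?_, ?_⟩
  · rw [SimpleGraph.Walk.cons_isCycle_iff]
    refine ⟨p.bypass_isPath.concat hq hj.symm, ?_⟩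
    rw [SimpleGraph.Walk.edges_concat]
    intro h
    rw [List.concat_eq_append, List.mem_append, List.mem_singleton] at h
    rcases h with h | h
    · exact hq (p.bypass.fst_mem_support_of_mem_edges h)
    · simp only [Sym2.eq_iff] at h
      rcases h with ⟨h, -⟩ | ⟨-, h⟩
      · exact hj.ne h
      · exact hij h
  · simp
  · simp [SimpleGraph.Walk.edges_concat, Sym2.eq_swap]

/-- Two nodes of a cycle other than `n` are joined by a walk avoiding `n`. -/
theorem exists_walk_of_isCycle [DecidableEq V] {n i j u : V} {p : G.Walk u u} (hp : p.IsCycle)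
    (hi : i ∈ p.support) (hj : j ∈ p.support) (hin : i ≠ n) (hjn : j ≠ n) :
    ∃ q : G.Walk i j, n ∉ q.support := by
  by_cases hn : n ∈ p.support
  -- Rotate the cycle to start at n and strip both end occurrences of n; what remains is a path
  -- through i and j avoiding n.
  · have hc : (p.rotate n hn).IsCycle := hp.rotate hn
    have hic : i ∈ (p.rotate n hn).support := by
      simpa [SimpleGraph.Walk.mem_support_rotate_iff] using hi
    have hjc : j ∈ (p.rotate n hn).support := by
      simpa [SimpleGraph.Walk.mem_support_rotate_iff] using hj
    generalize p.rotate n hn = c at hc hic hjc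
    cases c with
    | nil => simp at hc
    | cons h q =>
      have hq := ((SimpleGraph.Walk.cons_isCycle_iff _ _).1 hc).1.reverse
      have hi' : i ∈ q.reverse.support := by simpa [hin] using hic
      have hj' : j ∈ q.reverse.support := by simpa [hjn] using hjc
      generalize q.reverse = r at hq hi' hj'
      cases r with
      | nil => exact absurd h (G.irrefl)
      | cons h' r =>
        rw [SimpleGraph.Walk.cons_isPath_iff] at hq
        have hi'' : i ∈ r.support := by simpa [hin] using hi'
        have hj'' : j ∈ r.support := by simpa [hjn] using hj'
        refine ⟨(r.takeUntil i hi'').reverse.append (r.takeUntil j hj''), ?_⟩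
        rw [SimpleGraph.Walk.mem_support_append_iff]
        rintro (h | h)
        · exact hq.2 (r.support_takeUntil_subset_support _ (by simpa using h))
        · exact hq.2 (r.support_takeUntil_subset_support _ h)
  · refine ⟨(p.takeUntil i hi).reverse.append (p.takeUntil j hj), ?_⟩
    rw [SimpleGraph.Walk.mem_support_append_iff]
    rintro (h | h)
    · exact hn (p.support_takeUntil_subset_support _ (by simpa using h))
    · exact hn (p.support_takeUntil_subset_support _ h)

/-- A cycle contains at most two edges at a node. -/
theorem IsCycleSet.eq_or_eq [DecidableEq V] {C : Finset (Sym2 V)} (hC : IsCycleSet G C)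
    {n i j k : V} (hi : s(n, i) ∈ C) (hj : s(n, j) ∈ C) (hk : s(n, k) ∈ C) (hij : i ≠ j) :
    k = i ∨ k = j := by
  obtain ⟨u, p, hp, rfl⟩ := hC
  simp only [List.mem_toFinset] at hi hj hk
  have h2 := hp.ncard_neighborSet_toSubgraph_eq_two (p.fst_mem_support_of_mem_edges hi)
  by_contra! hne
  have hsub : ({i, j, k} : Set V) ⊆ p.toSubgraph.neighborSet n := by
    rintro x (rfl | rfl | rfl) <;>
      simpa [SimpleGraph.Subgraph.mem_neighborSet,
        SimpleGraph.Walk.adj_toSubgraph_iff_mem_edges]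
  have h3 : ({i, j, k} : Set V).ncard = 3 :=
    Set.ncard_eq_three.2 ⟨i, j, k, hij, hne.1.symm, hne.2.symm, rfl⟩
  have := Set.ncard_le_ncard hsub (Set.finite_of_ncard_ne_zero (by omega))
  omega

/-- Nodes are related if they are equal or joined by a walk avoiding `n`. -/
def avoidSetoid (G : SimpleGraph V) (n : V) : Setoid V where
  -- The disjunct `i = j` gives reflexivity at n itself, since every walk from n contains n.
  r i j := i = j ∨ ∃ p : G.Walk i j, n ∉ p.support
  iseqv :=
    { refl := fun i => Or.inl rfl
      symm := by
        rintro i j (rfl | ⟨p, hp⟩)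
        · exact Or.inl rfl
        · exact Or.inr ⟨p.reverse, by simpa using hp⟩
      trans := by
        rintro i j k (rfl | ⟨p, hp⟩) (rfl | ⟨q, hq⟩)
        · exact Or.inl rfl
        · exact Or.inr ⟨q, hq⟩
        · exact Or.inr ⟨p, hp⟩
        · refine Or.inr ⟨p.append q, ?_⟩
          rw [SimpleGraph.Walk.mem_support_append_iff]
          tauto }

open Classical in
/-- In a weakly cyclic network the neighbors of a node `n`, grouped by the connected components
that remain after removing `n`, form singletons and duples. -/
theorem IsWeaklyCyclic.nonempty_neighborPartition {V : Type*} [Fintype V] [DecidableEq V]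
    {G : SimpleGraph V} [DecidableRel G.Adj] (hG : IsWeaklyCyclic G) :
    Nonempty (NeighborPartition G) := by
  let parts : ∀ n : V, Finpartition (G.neighborFinset n) := fun n =>
    Finpartition.ofSetSetoid (avoidSetoid G n) (G.neighborFinset n)
  have hrel : ∀ n, ∀ S ∈ (parts n).parts, ∀ i ∈ S, ∀ j ∈ S, i ≠ j →
      ∃ C, IsCycleSet G C ∧ s(n, i) ∈ C ∧ s(n, j) ∈ C := by
    intro n S hS i hi j hj hij
    have hiN : G.Adj n i := by simpa using (parts n).subset hS hi
    have hjN : G.Adj n j := by simpa using (parts n).subset hS hj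
    have hSi : j ∈ (parts n).part i := by
      rw [(parts n).part_eq_of_mem hS hi]; exact hj
    rw [Finpartition.mem_part_ofSetSetoid_iff_rel] at hSi
    obtain ⟨-, -, h | ⟨p, hp⟩⟩ := hSi
    · exact absurd h hij
    · exact exists_isCycleSet_of_walk hiN hjN hij p hp
  have hcard : ∀ n, ∀ S ∈ (parts n).parts, S.card = 1 ∨ S.card = 2 := by
    intro n S hS
    have hpos : 0 < S.card := Finset.card_pos.2 ((parts n).nonempty_of_mem_parts hS)
    by_contra hne
    have h3 : 2 < S.card := by omega
    -- With three members, the cycles through i, j and through i, k share the edge n i, so weak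
    -- cyclicity identifies them, and one cycle has three edges at n.
    obtain ⟨i, hi, j, hj, k, hk, hij, hik, hjk⟩ := Finset.two_lt_card.1 h3
    obtain ⟨C, hC, hCi, hCj⟩ := hrel n S hS i hi j hj hij
    obtain ⟨C', hC', hCi', hCk'⟩ := hrel n S hS i hi k hk hik
    obtain rfl := hG C C' hC hC' _ hCi hCi'
    rcases hC.eq_or_eq hCi hCj hCk' hij with h | h
    · exact hik h.symm
    · exact hjk h.symm
  have hcyc : ∀ n S, ∃ C : Finset (Sym2 V), S ∈ (parts n).parts → S.card = 2 →
      IsCycleSet G C ∧ ∀ i ∈ S, s(n, i) ∈ C := by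
    intro n S
    by_cases h : S ∈ (parts n).parts ∧ S.card = 2
    · obtain ⟨hS, h2⟩ := h
      obtain ⟨i, j, hij, rfl⟩ := Finset.card_eq_two.1 h2
      obtain ⟨C, hC, hi, hj⟩ := hrel n _ hS i (by simp) j (by simp) hij
      exact ⟨C, fun _ _ => ⟨hC, by simp [hi, hj]⟩⟩
    · exact ⟨∅, fun h1 h2 => absurd ⟨h1, h2⟩ h⟩
  choose cyc hcyc using hcyc
  refine ⟨⟨parts, cyc, hcard, fun n S hS h2 => (hcyc n S hS h2).1,
    fun n S hS h2 => (hcyc n S hS h2).2, ?_⟩⟩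
  rintro n i j hij hi hj ⟨C, ⟨u, p, hp, rfl⟩, ⟨e, he, hie⟩, ⟨e', he', hje⟩⟩
  have hiN : G.Adj n i := by simpa using (parts n).subset hi (Finset.mem_singleton_self i)
  have hjN : G.Adj n j := by simpa using (parts n).subset hj (Finset.mem_singleton_self j)
  have hmem : ∀ x e, e ∈ p.edges.toFinset → x ∈ e → x ∈ p.support := by
    intro x e he hx
    obtain ⟨y, rfl⟩ := hx
    exact p.fst_mem_support_of_mem_edges (List.mem_toFinset.1 he)
  obtain ⟨q, hq⟩ := exists_walk_of_isCycle (n := n) hp (hmem i e he hie) (hmem j e' he' hje)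
    hiN.ne' hjN.ne'
  have hji : j ∈ (parts n).part i := by
    rw [Finpartition.mem_part_ofSetSetoid_iff_rel]
    exact ⟨by simpa, by simpa, Or.inr ⟨q, hq⟩⟩
  rw [(parts n).part_eq_of_mem hi (Finset.mem_singleton_self i), Finset.mem_singleton] at hji
  exact hij hji.symm

end Cycles

/-! ### Power flow: the weighted Laplacian -/

section Laplacian

variable {V : Type*} [Fintype V] (G : SimpleGraph V) [DecidableRel G.Adj]
  (B : Sym2 V → ℝ)

/-- The weighted Laplacian of a network: the net outflow at node `i` for the voltage angles `θ`. -/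
def lap : (V → ℝ) →ₗ[ℝ] (V → ℝ) where
  toFun θ i := ∑ j ∈ G.neighborFinset i, B s(i, j) * (θ i - θ j)
  map_add' θ η := by
    ext i
    simp only [Pi.add_apply, ← Finset.sum_add_distrib]
    exact Finset.sum_congr rfl fun j _ => by ring
  map_smul' a θ := by
    ext i
    simp only [Pi.smul_apply, smul_eq_mul, RingHom.id_apply, Finset.mul_sum]
    exact Finset.sum_congr rfl fun j _ => by ring

variable {G B}

theorem lap_apply (θ : V → ℝ) (i : V) :
    lap G B θ i = ∑ j ∈ G.neighborFinset i, B s(i, j) * (θ i - θ j) := rfl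

variable [DecidableEq V]

/-- The total injection of a set of nodes is the flow over its boundary. -/
theorem sum_lap_eq (θ : V → ℝ) (U : Finset V) :
    ∑ i ∈ U, lap G B θ i =
      ∑ i ∈ U, ∑ j ∈ Uᶜ, if G.Adj i j then B s(i, j) * (θ i - θ j) else 0 := by
  set w : V → V → ℝ := fun i j => if G.Adj i j then B s(i, j) * (θ i - θ j) else 0 with hw
  have hanti : ∀ i j, w i j = - w j i := by
    intro i j
    simp only [hw, G.adj_comm i j, Sym2.eq_swap (a := i) (b := j)]
    split_ifs <;> ring
  have h1 : ∀ i, lap G B θ i = ∑ j ∈ U, w i j + ∑ j ∈ Uᶜ, w i j := by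
    intro i
    rw [Finset.sum_add_sum_compl, lap_apply, ← Finset.sum_filter]
    congr 1
    ext j; simp
  have h0 : ∑ i ∈ U, ∑ j ∈ U, w i j = 0 := by
    have h2 : ∑ i ∈ U, ∑ j ∈ U, w i j = - ∑ i ∈ U, ∑ j ∈ U, w i j := by
      conv_lhs => rw [Finset.sum_comm]
      simp only [← Finset.sum_neg_distrib]
      exact Finset.sum_congr rfl fun i _ => Finset.sum_congr rfl fun j _ => hanti j i
    linarith
  simp only [h1, Finset.sum_add_distrib, h0, zero_add]
  rfl

theorem sum_lap (θ : V → ℝ) : ∑ i, lap G B θ i = 0 := by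
  simp [sum_lap_eq]

/-- Cut the network at the level θ i. All flow over the boundary of the superlevel set leaves it, so
a downhill line i j carries at most the total outflow, which is the injection inside the set. -/
theorem flow_le_sum_abs (hB : ∀ e, 0 < B e) (θ : V → ℝ) {i j : V} (hij : G.Adj i j) :
    B s(i, j) * (θ i - θ j) ≤ ∑ l, |lap G B θ l| := by
  rcases le_or_gt (θ i) (θ j) with h | h
  · exact (mul_nonpos_of_nonneg_of_nonpos (hB _).le (by linarith)).trans
      (Finset.sum_nonneg fun _ _ => abs_nonneg _)
  · set U : Finset V := Finset.univ.filter fun l => θ i ≤ θ l with hU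
    have hnn : ∀ a ∈ U, ∀ b ∈ Uᶜ,
        0 ≤ if G.Adj a b then B s(a, b) * (θ a - θ b) else 0 := by
      intro a ha b hb
      have ha : θ i ≤ θ a := by simpa [hU] using ha
      have hb : θ b < θ i := by simpa [hU] using hb
      split_ifs
      · exact mul_nonneg (hB _).le (by linarith)
      · exact le_rfl
    calc B s(i, j) * (θ i - θ j)
        = if G.Adj i j then B s(i, j) * (θ i - θ j) else 0 := by rw [if_pos hij]
      _ ≤ ∑ b ∈ Uᶜ, if G.Adj i b then B s(i, b) * (θ i - θ b) else 0 :=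
          Finset.single_le_sum (f := fun b => if G.Adj i b then B s(i, b) * (θ i - θ b) else 0)
            (hnn i (by simp [hU])) (by simpa [hU] using h)
      _ ≤ ∑ a ∈ U, ∑ b ∈ Uᶜ, if G.Adj a b then B s(a, b) * (θ a - θ b) else 0 :=
          Finset.single_le_sum
            (f := fun a => ∑ b ∈ Uᶜ, if G.Adj a b then B s(a, b) * (θ a - θ b) else 0)
            (fun a ha => Finset.sum_nonneg (hnn a ha)) (by simp [hU])
      _ = ∑ l ∈ U, lap G B θ l := (sum_lap_eq θ U).symm
      _ ≤ ∑ l ∈ U, |lap G B θ l| := Finset.sum_le_sum fun l _ => le_abs_self _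
      _ ≤ ∑ l, |lap G B θ l| :=
          Finset.sum_le_sum_of_subset_of_nonneg (Finset.subset_univ _) fun _ _ _ => abs_nonneg _

/-- No line carries more than the total of the absolute injections. -/
theorem abs_flow_le_sum_abs (hB : ∀ e, 0 < B e) (θ : V → ℝ) {i j : V} (hij : G.Adj i j) :
    |B s(i, j) * (θ i - θ j)| ≤ ∑ l, |lap G B θ l| := by
  refine abs_le'.2 ⟨flow_le_sum_abs hB θ hij, ?_⟩
  have := flow_le_sum_abs hB θ hij.symm
  rw [Sym2.eq_swap] at this
  linarith

/-- On a connected network every balanced injection vector has voltage angles. -/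
theorem exists_lap_eq (hG : G.Connected) (hB : ∀ e, 0 < B e) {y : V → ℝ} (hy : ∑ i, y i = 0) :
    ∃ θ, lap G B θ = y := by
  have hV : (0 : ℝ) < Fintype.card V := by
    have := hG.nonempty
    exact_mod_cast Fintype.card_pos
  -- The Laplacian kills constants; adding the sum of the angles to each coordinate makes it
  -- injective, hence surjective. Total injections vanish, so on balanced y the added term is zero.
  let T : (V → ℝ) →ₗ[ℝ] (V → ℝ) :=
    { toFun := fun θ => lap G B θ + fun _ => ∑ i, θ i
      map_add' := by
        intro θ η
        ext i
        simp only [map_add, Pi.add_apply, Finset.sum_add_distrib]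
        ring
      map_smul' := by
        intro a θ
        ext i
        simp only [map_smul, Pi.add_apply, Pi.smul_apply, smul_eq_mul, RingHom.id_apply,
          ← Finset.mul_sum]
        ring }
  have hT : ∀ θ, T θ = lap G B θ + fun _ => ∑ i, θ i := fun _ => rfl
  have hsum : ∀ θ, ∑ i, T θ i = Fintype.card V * ∑ i, θ i := by
    intro θ
    simp [hT, Finset.sum_add_distrib, sum_lap]
  have hinj : Function.Injective T := by
    rw [injective_iff_map_eq_zero]
    intro θ hθ
    have h0 : ∑ i, θ i = 0 := by
      have := hsum θ
      simp only [hθ, Pi.zero_apply, Finset.sum_const_zero] at this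
      rcases mul_eq_zero.1 this.symm with h | h
      · exact absurd h hV.ne'
      · exact h
    have hl : lap G B θ = 0 := by
      have := hT θ
      rw [hθ, h0] at this
      ext i
      simpa using (congrFun this i).symm
    have hadj : ∀ i j, G.Adj i j → θ i = θ j := by
      intro i j hij
      have := abs_flow_le_sum_abs hB θ hij
      simp only [hl, Pi.zero_apply, abs_zero, Finset.sum_const_zero, abs_nonpos_iff,
        mul_eq_zero, (hB _).ne', false_or] at this
      linarith
    have hconst : ∀ i j, θ i = θ j := by
      intro i j
      obtain ⟨p⟩ := hG.preconnected i j
      induction p with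
      | nil => rfl
      | cons h _ ih => exact (hadj _ _ h).trans ih
    ext i
    have : ∑ j, θ j = Fintype.card V * θ i := by
      simp [fun j => hconst j i]
    rw [h0] at this
    rcases mul_eq_zero.1 this.symm with h | h
    · exact absurd h hV.ne'
    · exact h
  obtain ⟨θ, hθ⟩ := LinearMap.injective_iff_surjective.1 hinj y
  have h0 : ∑ i, θ i = 0 := by
    have := hsum θ
    rw [hθ, hy] at this
    rcases mul_eq_zero.1 this.symm with h | h
    · exact absurd h hV.ne'
    · exact h
  refine ⟨θ, ?_⟩
  have := hT θ
  rw [h0, hθ] at this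
  ext i
  simpa using (congrFun this i).symm

/-- If all lines off a non-cut node `v` have admittance `b` and those at `v` have admittance `1`,
then the injection at `v` spreads evenly over the lines at `v`, up to an error of order `1 / b`. -/
theorem abs_flow_sub_le {v : V} (hv : (G.induce {v}ᶜ).Connected) {b : ℝ} (hb : 0 < b)
    (hB : ∀ e, B e = if v ∈ e then 1 else b) (θ : V → ℝ) {j : V} (hj : G.Adj v j) :
    |G.degree v * (θ v - θ j) - lap G B θ v| ≤
      G.degree v * (Fintype.card V * (∑ l, |lap G B θ l|) / b) := by
  set T := ∑ l, |lap G B θ l| with hT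
  have hT0 : 0 ≤ T := Finset.sum_nonneg fun _ _ => abs_nonneg _
  have hBpos : ∀ e, 0 < B e := fun e => by rw [hB]; split_ifs <;> linarith
  -- Bounded flow over admittance b forces nearly equal angles; chaining along a path avoiding v
  -- makes all angles off v nearly equal.
  have hedge : ∀ i k, i ≠ v → k ≠ v → G.Adj i k → |θ i - θ k| ≤ T / b := by
    intro i k hi hk hik
    have := abs_flow_le_sum_abs hBpos θ hik
    rw [hB, if_neg (by simp [hi.symm, hk.symm]), abs_mul, abs_of_pos hb] at this
    rw [le_div_iff₀ hb]
    linarith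
  have hwalk : ∀ (x y : ({v}ᶜ : Set V)) (p : (G.induce {v}ᶜ).Walk x y),
      |θ x - θ y| ≤ p.length * (T / b) := by
    intro x y p
    induction p with
    | nil => simp
    | @cons x z y h p ih =>
      have h1 := hedge x z x.2 z.2 h
      have h2 : |θ x - θ y| ≤ |θ x - θ z| + |θ z - θ y| := abs_sub_le _ _ _
      rw [SimpleGraph.Walk.length_cons]
      push_cast
      linarith
  have hpair : ∀ i k, i ≠ v → k ≠ v → |θ i - θ k| ≤ Fintype.card V * T / b := by
    intro i k hi hk
    obtain ⟨p, hp⟩ := (hv.preconnected ⟨i, hi⟩ ⟨k, hk⟩).exists_isPath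
    have h1 := hwalk _ _ p
    have h2 : (p.length : ℝ) ≤ Fintype.card V := by
      have := hp.length_lt
      have h3 := Fintype.card_subtype_le (fun x : V => x ∈ ({v}ᶜ : Set V))
      exact_mod_cast (this.le.trans (by convert h3))
    have h4 : 0 ≤ T / b := div_nonneg hT0 hb.le
    calc |θ i - θ k| ≤ p.length * (T / b) := h1
      _ ≤ Fintype.card V * (T / b) := mul_le_mul_of_nonneg_right h2 h4
      _ = _ := by ring
  have hlap : G.degree v * (θ v - θ j) - lap G B θ v
      = ∑ k ∈ G.neighborFinset v, (θ k - θ j) := by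
    rw [lap_apply, ← SimpleGraph.card_neighborFinset_eq_degree, ← nsmul_eq_mul,
      ← Finset.sum_const, ← Finset.sum_sub_distrib]
    refine Finset.sum_congr rfl fun k _ => ?_
    rw [hB, if_pos (by simp)]
    ring
  rw [hlap, ← SimpleGraph.card_neighborFinset_eq_degree, ← nsmul_eq_mul]
  refine (Finset.abs_sum_le_sum_abs _ _).trans (Finset.sum_le_card_nsmul _ _ _ fun k hk => ?_)
  exact hpair k j (by simpa using (G.ne_of_adj ((G.mem_neighborFinset v k).1 hk)).symm) hj.ne'

end Laplacian

/-! ### The cost function of the cheap supplier -/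

section CostFunction

/-- A cost function with marginal cost `(s / A) ^ k` on `[0, A]` and `1` on `[A, ∞)`. -/
noncomputable def hockeyCost (A : ℝ) (k : ℕ) (s : ℝ) : ℝ :=
  ∫ u in (0 : ℝ)..s, (max 0 (min 1 (u / A))) ^ k

variable {A : ℝ} {k : ℕ}

theorem hockeyCost_zero : hockeyCost A k 0 = 0 := intervalIntegral.integral_same

theorem hasDerivAt_hockeyCost (s : ℝ) :
    HasDerivAt (hockeyCost A k) ((max 0 (min 1 (s / A))) ^ k) s := by
  have hc : Continuous fun u : ℝ => (max 0 (min 1 (u / A))) ^ k := by fun_prop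
  exact intervalIntegral.integral_hasDerivAt_right (hc.intervalIntegrable _ _)
    (hc.stronglyMeasurableAtFilter _ _) hc.continuousAt

theorem convexOn_hockeyCost (hA : 0 < A) : ConvexOn ℝ Set.univ (hockeyCost A k) := by
  refine Monotone.convexOn_univ_of_deriv
    (fun s => (hasDerivAt_hockeyCost s).differentiableAt) ?_
  intro s t hst
  rw [(hasDerivAt_hockeyCost s).deriv, (hasDerivAt_hockeyCost t).deriv]
  gcongr

theorem strictMonoOn_hockeyCost (hA : 0 < A) :
    StrictMonoOn (hockeyCost A k) (Set.Ici 0) := by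
  refine strictMonoOn_of_deriv_pos (convex_Ici 0)
    (fun s _ => (hasDerivAt_hockeyCost s).continuousAt.continuousWithinAt) ?_
  intro s hs
  rw [interior_Ici, Set.mem_Ioi] at hs
  rw [(hasDerivAt_hockeyCost s).deriv]
  have : 0 < min 1 (s / A) := lt_min one_pos (div_pos hs hA)
  exact pow_pos (lt_max_of_lt_right this) k

/-- Large k makes the first A units almost free, while the cost stays differentiable, convex and
strictly increasing. -/
theorem hockeyCost_self (hA : 0 < A) : hockeyCost A k A = A / (k + 1) := by
  have h : hockeyCost A k A = ∫ u in (0 : ℝ)..A, (u / A) ^ k := by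
    refine intervalIntegral.integral_congr fun u hu => ?_
    rw [Set.uIcc_of_le hA.le] at hu
    have h1 : u / A ≤ 1 := (div_le_one hA).2 hu.2
    simp only [min_eq_right h1, max_eq_right (div_nonneg hu.1 hA.le)]
  rw [h, intervalIntegral.integral_comp_div (fun x => x ^ k) hA.ne', integral_pow]
  simp [hA.ne']
  ring

theorem hockeyCost_of_le (hA : 0 < A) {s : ℝ} (hs : A ≤ s) :
    hockeyCost A k s = A / (k + 1) + (s - A) := by
  have hc : Continuous fun u : ℝ => (max 0 (min 1 (u / A))) ^ k := by fun_prop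
  have h : ∫ u in A..s, (max 0 (min 1 (u / A))) ^ k = ∫ u in A..s, (1 : ℝ) := by
    refine intervalIntegral.integral_congr fun u hu => ?_
    rw [Set.uIcc_of_le hs] at hu
    have h1 : 1 ≤ u / A := (one_le_div hA).2 hu.1
    simp [min_eq_left h1]
  have h2 : hockeyCost A k s = hockeyCost A k A + ∫ u in A..s, (max 0 (min 1 (u / A))) ^ k :=
    (intervalIntegral.integral_add_adjacent_intervals (hc.intervalIntegrable _ _)
      (hc.intervalIntegrable _ _)).symm
  rw [h2, h, hockeyCost_self hA]
  simp

end CostFunction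

/-! ### The worst-case market and its flows -/

/-- Conditions on the network and the parameters of `worstMarket`: `v` is not a cut node, `D` is
large, `σ` is small, and `b` is large. -/
structure WorstParams {V : Type*} [Fintype V] (G : SimpleGraph V) (v : V) (D σ b : ℝ) : Prop where
  conn : G.Connected
  conn_compl : (G.induce {v}ᶜ).Connected
  three_le : 3 ≤ Fintype.card V
  σ_pos : 0 < σ
  σ_le : Fintype.card V * σ ≤ 1
  D_ge : 10 * Fintype.card V ≤ D
  -- The two bounds on b keep the error in the even split at `v` below X / 2 when X units move away
  -- from `v`, and below σ along a rival's deviation.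
  b_ge : 4 * (Fintype.card V : ℝ) ^ 2 ≤ b
  b_ge' : 2 * (Fintype.card V : ℝ) ^ 3 * D / σ ≤ b

namespace WorstParams

variable {V : Type*} [Fintype V] {G : SimpleGraph V} {v : V} {D σ b : ℝ}

theorem three_le' (h : WorstParams G v D σ b) : (3 : ℝ) ≤ Fintype.card V := by
  exact_mod_cast h.three_le

theorem D_pos (h : WorstParams G v D σ b) : 0 < D := by
  linarith [h.D_ge, h.three_le']

theorem card_mul_σ (h : WorstParams G v D σ b) :
    0 ≤ ((Fintype.card V : ℝ) - 1) * σ ∧ ((Fintype.card V : ℝ) - 1) * σ + σ ≤ 1 := by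
  have := h.σ_le
  have := h.three_le'
  have := h.σ_pos
  constructor <;> nlinarith

theorem D_le (h : WorstParams G v D σ b) :
    D ≤ ((Fintype.card V : ℝ) - 2) * D := by
  have := h.three_le'
  have := h.D_pos
  nlinarith

theorem σ_le_one (h : WorstParams G v D σ b) : σ ≤ 1 := by
  linarith [h.card_mul_σ]

theorem b_pos (h : WorstParams G v D σ b) : 0 < b := by
  nlinarith [h.b_ge, h.three_le']

theorem admittance_pos [DecidableEq V] (h : WorstParams G v D σ b) (e : Sym2 V) :
    0 < (if v ∈ e then 1 else b : ℝ) := by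
  split_ifs
  · exact one_pos
  · exact h.b_pos

theorem one_le_degree [DecidableRel G.Adj] (h : WorstParams G v D σ b) :
    (1 : ℝ) ≤ G.degree v := by
  have : Nontrivial V := Fintype.one_lt_card_iff_nontrivial.1 (by have := h.three_le; omega)
  exact_mod_cast Nat.one_le_iff_ne_zero.2 (h.conn.preconnected.degree_pos_of_nontrivial v).ne'

theorem degree_le [DecidableRel G.Adj] : (G.degree v : ℝ) ≤ Fintype.card V := by
  exact_mod_cast (G.degree_lt_card_verts v).le

end WorstParams

section WorstMarket

variable {V : Type*} [Fintype V] [DecidableEq V]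

/-- A supply profile in which all suppliers but `v` produce `σ`. -/
def baseSupply (v : V) (D σ : ℝ) (i : V) : ℝ :=
  if i = v then D - (Fintype.card V - 1) * σ else σ

/-- The perceived marginal cost of a supplier is its marginal cost times `1 + s / E`; at the
marginal cost `worstSlope` the suppliers other than `v` producing at most `σ + 1` perceive at most
what `v` perceives when producing one unit less than in `baseSupply`. -/
noncomputable def worstSlope (V : Type*) [Fintype V] (D σ : ℝ) : ℝ :=
  ((Fintype.card V - 2) * D + (D - (Fintype.card V - 1) * σ - 1)) /
    ((Fintype.card V - 2) * D + (σ + 1))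

/-- A market in which nearly all demand is located at `v`, and `v` can cheaply serve all but the
last unit of the demand. Lines away from `v` have the large admittance `b`. -/
noncomputable def worstMarket (G : SimpleGraph V) [DecidableRel G.Adj] (v : V) (D σ b : ℝ)
    (k : ℕ) : Market V where
  -- Demand is chosen so that `baseSupply` has the angles `Pi.single v 1`: flow exactly 1 out of v
  -- on each of its lines, and none elsewhere.
  d i := baseSupply v D σ i - lap G (fun e => if v ∈ e then 1 else b) (Pi.single v 1) i
  gens := Finset.univ
  cost i := if i = v then hockeyCost (D - (Fintype.card V - 1) * σ - 1) k
    else fun s => worstSlope V D σ * s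
  -- The lower limit of v sits at the kink of its cost; exactly one unit of supply remains free.
  slo i := if i = v then D - (Fintype.card V - 1) * σ - 1 else σ
  shi _ := 2 * D
  -- Limit 1 is the base flow; limit 3 is slack, since moving at most one unit causes flows of at
  -- most 2.
  f e := if v ∈ e then 1 else 3
  B e := if v ∈ e then 1 else b

variable {G : SimpleGraph V} [DecidableRel G.Adj] {v : V} {D σ b : ℝ} {k : ℕ}

theorem sum_baseSupply (v : V) (D σ : ℝ) : ∑ i, baseSupply v D σ i = D := by
  have h : ∀ i, baseSupply v D σ i =
      σ + if i = v then D - Fintype.card V * σ else 0 := by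
    intro i
    unfold baseSupply
    split_ifs <;> ring
  simp [h, Finset.sum_add_distrib]

theorem totalDemand_worstMarket : (worstMarket G v D σ b k).totalDemand = D := by
  simp [Market.totalDemand, worstMarket, Finset.sum_sub_distrib, sum_lap, sum_baseSupply]

/-- Voltage angles are the base angles plus angles for the deviation from `baseSupply`. -/
theorem isAngle_worstMarket {s θ : V → ℝ} (hθ : lap G (fun e => if v ∈ e then 1 else b) θ =
    s - baseSupply v D σ) :
    (worstMarket G v D σ b k).IsAngle G s (Pi.single v 1 + θ) := by
  intro i
  have h := congrFun hθ i
  have h2 : lap G (fun e => if v ∈ e then 1 else b) (Pi.single v 1 + θ) i =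
      lap G (fun e => if v ∈ e then 1 else b) (Pi.single v 1) i +
      lap G (fun e => if v ∈ e then 1 else b) θ i := by rw [map_add]; rfl
  change lap G (fun e => if v ∈ e then 1 else b) (Pi.single v 1 + θ) i = _
  rw [h2, h]
  simp only [Market.injection, worstMarket, Finset.mem_univ, if_true, Pi.sub_apply]
  ring

/-- Flow limits of `worstMarket` in terms of angles for the deviation from `baseSupply`. -/
theorem flow_cases {θ : V → ℝ} {R : ℝ → ℝ → Prop}
    (h1 : ∀ j, G.Adj v j → R |1 + (θ v - θ j)| 1)
    (h2 : ∀ i j, G.Adj i j → i ≠ v → j ≠ v → R |b * (θ i - θ j)| 3)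
    (i j : V) (hij : G.Adj i j) :
    R |(worstMarket G v D σ b k).B s(i, j) *
      ((Pi.single v 1 + θ : V → ℝ) i - (Pi.single v 1 + θ : V → ℝ) j)|
      ((worstMarket G v D σ b k).f s(i, j)) := by
  simp only [worstMarket, Pi.add_apply]
  by_cases hi : i = v
  · subst hi
    have := h1 j hij
    simp only [Sym2.mem_iff, true_or, if_true, Pi.single_eq_same,
      Pi.single_eq_of_ne hij.ne', one_mul]
    convert this using 2
    ring
  · by_cases hj : j = v
    · subst hj
      have := h1 i hij.symm
      simp only [Sym2.mem_iff, or_true, if_true, Pi.single_eq_same,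
        Pi.single_eq_of_ne hi, one_mul]
      rw [abs_sub_comm]
      convert this using 2
      ring
    · have := h2 i j hij hi hj
      have hv : v ∉ s(i, j) := by simp [Ne.symm hi, Ne.symm hj]
      simp only [if_neg hv, Pi.single_eq_of_ne hi, Pi.single_eq_of_ne hj, zero_add]
      exact this

/-- Within the capacity limits the flow over lines at `v` does not exceed the base flow, and all
other limits are slack. -/
theorem exists_angle_of_box (h : WorstParams G v D σ b) {s : V → ℝ} (hs : ∑ i, s i = D)
    (hlo : ∀ i, (worstMarket G v D σ b k).slo i ≤ s i) :
    ∃ θ, lap G (fun e => if v ∈ e then 1 else b) θ = s - baseSupply v D σ ∧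
      (∀ j, G.Adj v j → θ v - θ j ≤ 0 ∧ -2 < θ v - θ j ∧
        (s v < D - (Fintype.card V - 1) * σ → θ v - θ j < 0)) ∧
      ∀ i j, G.Adj i j → i ≠ v → j ≠ v → |b * (θ i - θ j)| < 3 := by
  have hn := h.three_le'
  set y : V → ℝ := s - baseSupply v D σ with hy
  have hy0 : ∑ i, y i = 0 := by
    simp [hy, Finset.sum_sub_distrib, hs, sum_baseSupply]
  obtain ⟨θ, hθ⟩ := exists_lap_eq h.conn h.admittance_pos hy0
  have hyk : ∀ i, i ≠ v → 0 ≤ y i := by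
    intro i hi
    have := hlo i
    simp only [worstMarket, if_neg hi] at this
    simp only [hy, Pi.sub_apply, baseSupply, if_neg hi]
    linarith
  have hsplit : y v + ∑ i ∈ Finset.univ.erase v, y i = 0 := by
    rw [Finset.add_sum_erase _ _ (Finset.mem_univ v), hy0]
  have hnn : 0 ≤ ∑ i ∈ Finset.univ.erase v, y i :=
    Finset.sum_nonneg fun i hi => hyk i (Finset.ne_of_mem_erase hi)
  -- X is the amount moved from v to the others. As they all stay above their base supply, the
  -- absolute deviations sum to 2 X.
  set X := - y v with hX
  have hX0 : 0 ≤ X := by linarith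
  have hXv : X = D - (Fintype.card V - 1) * σ - s v := by
    simp only [hX, hy, Pi.sub_apply, baseSupply, if_true]; ring
  have hX1 : X ≤ 1 := by
    have := hlo v
    simp only [worstMarket, if_true] at this
    linarith
  have habs : ∑ i, |y i| = 2 * X := by
    rw [← Finset.add_sum_erase _ _ (Finset.mem_univ v),
      Finset.sum_congr rfl fun i hi => abs_of_nonneg (hyk i (Finset.ne_of_mem_erase hi)),
      abs_of_nonpos (by linarith)]
    linarith
  have hd := h.one_le_degree
  have hd' := WorstParams.degree_le (G := G) (v := v)
  -- Even splitting: degree times flow is -X up to an error X / 2, so no line at v gains flow.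
  have hflow : ∀ j, G.Adj v j → G.degree v * (θ v - θ j) ≤ - (X / 2) ∧
      - (3 * X / 2) ≤ G.degree v * (θ v - θ j) := by
    intro j hj
    have h1 := abs_flow_sub_le h.conn_compl h.b_pos (fun _ => rfl) θ hj
    rw [hθ, habs] at h1
    have h2 : G.degree v * (Fintype.card V * (2 * X) / b) ≤ X / 2 := by
      have h3 : (Fintype.card V : ℝ) * (2 * X) / b ≤ X / (2 * Fintype.card V) := by
        rw [div_le_div_iff₀ h.b_pos (by linarith)]
        have := h.b_ge
        nlinarith
      calc G.degree v * (Fintype.card V * (2 * X) / b)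
          ≤ Fintype.card V * (X / (2 * Fintype.card V)) :=
            mul_le_mul hd' h3 (div_nonneg (by positivity) h.b_pos.le) (by positivity)
        _ = X / 2 := by field_simp
    have h4 := abs_le.1 (h1.trans h2)
    constructor <;> linarith [h4.1, h4.2]
  refine ⟨θ, hθ, fun j hj => ?_, fun i j hij hi hj => ?_⟩
  · obtain ⟨h1, h2⟩ := hflow j hj
    refine ⟨?_, ?_, fun hlt => ?_⟩
    · by_contra! hc
      nlinarith
    · by_contra! hc
      nlinarith
    · by_contra! hc
      have : 0 < X := by linarith
      nlinarith
  · have h1 := abs_flow_le_sum_abs h.admittance_pos θ hij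
    rw [hθ, habs, if_neg (by simp [Ne.symm hi, Ne.symm hj])] at h1
    linarith

/-- The base flow 1 plus a change in (-2, 0] stays in [-1, 1], so the lower capacity limits alone
imply all flow limits. -/
theorem flowOK_of_box (h : WorstParams G v D σ b) {s : V → ℝ} (hs : ∑ i, s i = D)
    (hlo : ∀ i, (worstMarket G v D σ b k).slo i ≤ s i) :
    (worstMarket G v D σ b k).FlowOK G s := by
  obtain ⟨θ, hθ, h1, h2⟩ := exists_angle_of_box h hs hlo
  refine ⟨_, isAngle_worstMarket hθ, flow_cases (R := (· ≤ ·)) (fun j hj => ?_)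
    fun i j hij hi hj => (h2 i j hij hi hj).le⟩
  obtain ⟨h3, h4, -⟩ := h1 j hj
  exact abs_le.2 ⟨by linarith, by linarith⟩

theorem flowStrict_of_box (h : WorstParams G v D σ b) {s : V → ℝ} (hs : ∑ i, s i = D)
    (hlo : ∀ i, (worstMarket G v D σ b k).slo i ≤ s i)
    (hv : s v < D - (Fintype.card V - 1) * σ) :
    (worstMarket G v D σ b k).FlowStrict G s := by
  obtain ⟨θ, hθ, h1, h2⟩ := exists_angle_of_box h hs hlo
  refine ⟨_, isAngle_worstMarket hθ, flow_cases (R := (· < ·)) (fun j hj => ?_) h2⟩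
  obtain ⟨-, h4, h5⟩ := h1 j hj
  exact abs_lt.2 ⟨by linarith, by linarith [h5 hv]⟩

/-- The direction in which the supply profile `s` moves when supplier `m` lowers its action. -/
def deviation (D : ℝ) (s : V → ℝ) (m i : V) : ℝ :=
  if i = m then (Fintype.card V - 2) * D + s m else -(D - s i)

theorem sum_deviation {s : V → ℝ} (hs : ∑ i, s i = D) (m : V) :
    ∑ i, deviation D s m i = 0 := by
  have h : ∀ i, deviation D s m i = s i - D + if i = m then (Fintype.card V : ℝ) * D - D else 0 := by
    intro i
    unfold deviation
    split_ifs with hi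
    · subst hi; ring
    · ring
  simp only [h, Finset.sum_add_distrib, Finset.sum_sub_distrib, hs, Finset.sum_const,
    Finset.card_univ, nsmul_eq_mul, Finset.sum_ite_eq', Finset.mem_univ, if_true]
  ring

/-- A supplier other than `v` can always increase its supply without violating flow limits. -/
theorem eventually_flowOK (h : WorstParams G v D σ b) {s : V → ℝ} (hs : ∑ i, s i = D)
    (hlo : ∀ i, (worstMarket G v D σ b k).slo i ≤ s i) {m : V} (hm : m ≠ v) :
    ∀ᶠ τ : ℝ in 𝓝[>] 0, (worstMarket G v D σ b k).FlowOK G (s + τ • deviation D s m) := by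
  have hn := h.three_le'
  obtain ⟨θ, hθ, h1, h2⟩ := exists_angle_of_box h hs hlo
  obtain ⟨η, hη⟩ := exists_lap_eq h.conn h.admittance_pos (sum_deviation hs m)
  have hσ := h.σ_pos
  have hslo : ∀ i, σ ≤ s i := by
    intro i
    refine le_trans ?_ (hlo i)
    simp only [worstMarket]
    split_ifs
    · nlinarith [h.σ_le, h.D_ge]
    · exact le_rfl
  have hle : ∀ i, s i ≤ D := by
    intro i
    rw [← hs]
    exact Finset.single_le_sum (f := s) (fun j _ => hσ.le.trans (hslo j)) (Finset.mem_univ i)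
  -- Along the deviation the injection at v falls at rate D - s v. At least two others produce σ or
  -- more, so this rate beats the splitting error σ.
  have hvlt : 2 * σ ≤ D - s v := by
    have h3 : s v + ∑ i ∈ Finset.univ.erase v, s i = D := by
      rw [Finset.add_sum_erase _ _ (Finset.mem_univ v), hs]
    have h4 : (Finset.univ.erase v).card • σ ≤ ∑ i ∈ Finset.univ.erase v, s i :=
      Finset.card_nsmul_le_sum _ _ _ fun i _ => hslo i
    have h5 : (2 : ℝ) ≤ (Finset.univ.erase v).card := by
      rw [Finset.card_erase_of_mem (Finset.mem_univ v), Finset.card_univ]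
      have := h.three_le
      exact_mod_cast (by omega : 2 ≤ Fintype.card V - 1)
    rw [nsmul_eq_mul] at h4
    nlinarith
  have habs : ∑ i, |deviation D s m i| ≤ 2 * Fintype.card V * D := by
    have h3 : ∀ i, |deviation D s m i| ≤ D + if i = m then (Fintype.card V - 1 : ℝ) * D else 0 := by
      intro i
      have := hslo i
      have := hle i
      have := h.D_pos
      unfold deviation
      split_ifs with hi
      · subst hi
        rw [abs_of_nonneg (by nlinarith)]
        nlinarith
      · rw [abs_of_nonpos (by linarith)]
        linarith
    refine (Finset.sum_le_sum fun i _ => h3 i).trans ?_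
    simp only [Finset.sum_add_distrib, Finset.sum_const, Finset.card_univ, nsmul_eq_mul,
      Finset.sum_ite_eq', Finset.mem_univ, if_true]
    have := h.D_pos
    nlinarith
  have hd := h.one_le_degree
  have hd' := WorstParams.degree_le (G := G) (v := v)
  have hflow : ∀ j, G.Adj v j → η v - η j < 0 := by
    intro j hj
    have h3 := abs_flow_sub_le h.conn_compl h.b_pos (fun _ => rfl) η hj
    rw [hη] at h3
    have h4 : G.degree v * (Fintype.card V * (∑ i, |deviation D s m i|) / b) ≤ σ := by
      calc G.degree v * (Fintype.card V * (∑ i, |deviation D s m i|) / b)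
          ≤ Fintype.card V * (Fintype.card V * (2 * Fintype.card V * D) / b) := by
            have := h.b_pos
            gcongr
        _ = 2 * (Fintype.card V : ℝ) ^ 3 * D / b := by ring
        _ ≤ σ := by
            have := h.b_ge'
            rw [div_le_iff₀ hσ] at this
            rw [div_le_iff₀ h.b_pos]
            linarith
    have h5 := (abs_le.1 (h3.trans h4)).2
    simp only [deviation, if_neg hm.symm] at h5
    by_contra! hc
    nlinarith
  have hlap : ∀ τ : ℝ, lap G (fun e => if v ∈ e then 1 else b) (θ + τ • η) =
      (s + τ • deviation D s m) - baseSupply v D σ := by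
    intro τ
    rw [map_add, map_smul, hθ, hη]
    ext i
    simp only [Pi.add_apply, Pi.sub_apply, Pi.smul_apply]
    ring
  -- The strict limits survive small τ by continuity. Only the upper limit at v can be tight, and
  -- `hflow` moves away from it.
  have ev1 : ∀ᶠ τ : ℝ in 𝓝[>] 0, ∀ j, G.Adj v j → -2 < (θ + τ • η) v - (θ + τ • η) j := by
    rw [eventually_all]
    intro j
    by_cases hj : G.Adj v j
    · have hc : Continuous fun τ : ℝ => (θ + τ • η) v - (θ + τ • η) j := by
        simp only [Pi.add_apply, Pi.smul_apply, smul_eq_mul]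
        fun_prop
      have := (hc.tendsto 0).eventually_const_lt (u := -2) (by simpa using (h1 j hj).2.1)
      exact (this.filter_mono nhdsWithin_le_nhds).mono fun τ hτ _ => hτ
    · exact Eventually.of_forall fun τ h => absurd h hj
  have ev2 : ∀ᶠ τ : ℝ in 𝓝[>] 0, ∀ i j, G.Adj i j → i ≠ v → j ≠ v →
      |b * ((θ + τ • η) i - (θ + τ • η) j)| < 3 := by
    rw [eventually_all]
    intro i
    rw [eventually_all]
    intro j
    by_cases hj : G.Adj i j ∧ i ≠ v ∧ j ≠ v
    · have hc : Continuous fun τ : ℝ => |b * ((θ + τ • η) i - (θ + τ • η) j)| := by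
        simp only [Pi.add_apply, Pi.smul_apply, smul_eq_mul]
        fun_prop
      have := (hc.tendsto 0).eventually_lt_const (u := 3)
        (by simpa using h2 i j hj.1 hj.2.1 hj.2.2)
      exact (this.filter_mono nhdsWithin_le_nhds).mono fun τ hτ _ _ _ => hτ
    · exact Eventually.of_forall fun τ h h' h'' => absurd ⟨h, h', h''⟩ hj
  filter_upwards [ev1, ev2, self_mem_nhdsWithin] with τ e1 e2 hτ
  refine ⟨_, isAngle_worstMarket (hlap τ), flow_cases (R := (· ≤ ·)) (fun j hj => ?_)
    fun i j hij hi hj => (e2 i j hij hi hj).le⟩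
  have h3 := e1 j hj
  have h4 := hflow j hj
  have h5 := (h1 j hj).1
  refine abs_le.2 ⟨by linarith, ?_⟩
  simp only [Pi.add_apply, Pi.smul_apply, smul_eq_mul]
  have : (τ : ℝ) * (η v - η j) ≤ 0 := mul_nonpos_of_nonneg_of_nonpos (le_of_lt hτ) h4.le
  linarith

end WorstMarket

/-! ### Unilateral deviations -/

namespace Market

variable {V : Type*} [Fintype V] {M : Market V}

theorem sum_actions (hg : M.gens = Finset.univ) (hD : 0 < M.totalDemand)
    (hn : (3 : ℝ) ≤ Fintype.card V) (w : V → ℝ) :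
    ∑ i, w i = (Fintype.card V - 1) * M.totalDemand * M.price w := by
  have h : ((Fintype.card V : ℝ) - 1) * M.totalDemand ≠ 0 := (mul_pos (by linarith) hD).ne'
  rw [price, hg, Finset.card_univ, mul_div_cancel₀ _ h]

theorem sum_supply (hg : M.gens = Finset.univ) (hD : 0 < M.totalDemand)
    (hn : (3 : ℝ) ≤ Fintype.card V) {w : V → ℝ} (hp : 0 < M.price w) :
    ∑ i, M.supply w i = M.totalDemand := by
  simp only [supply, Finset.sum_sub_distrib, ← Finset.sum_div, sum_actions hg hD hn w,
    Finset.sum_const, Finset.card_univ, nsmul_eq_mul]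
  field_simp
  ring

variable [DecidableEq V]

/-- The price is affine in a supplier's own action, so a deviation amounts to choosing a new price.
-/
theorem action_eq_of_update (hg : M.gens = Finset.univ) (hD : 0 < M.totalDemand)
    (hn : (3 : ℝ) ≤ Fintype.card V) (w : V → ℝ) (m : V) (x : ℝ) :
    x = w m + (Fintype.card V - 1) * M.totalDemand *
      (M.price (Function.update w m x) - M.price w) := by
  have h1 := sum_actions hg hD hn w
  have h2 := sum_actions hg hD hn (Function.update w m x)
  rw [Finset.sum_update_of_mem (Finset.mem_univ m), ← Finset.erase_eq] at h2
  rw [← Finset.add_sum_erase _ _ (Finset.mem_univ m)] at h1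
  linarith

theorem price_update (hg : M.gens = Finset.univ) (hD : 0 < M.totalDemand)
    (hn : (3 : ℝ) ≤ Fintype.card V) (w : V → ℝ) (m : V) (q : ℝ) :
    M.price (Function.update w m
      (w m + (Fintype.card V - 1) * M.totalDemand * (q - M.price w))) = q := by
  have h := action_eq_of_update hg hD hn w m
    (w m + (Fintype.card V - 1) * M.totalDemand * (q - M.price w))
  have h2 : ((Fintype.card V : ℝ) - 1) * M.totalDemand ≠ 0 := (mul_pos (by linarith) hD).ne'
  have h3 := mul_left_cancel₀ h2 (add_left_cancel h)
  linarith

/-- When supplier `m` moves the price, the supply profile moves along `deviation`. -/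
theorem supply_update (hg : M.gens = Finset.univ) (hD : 0 < M.totalDemand)
    (hn : (3 : ℝ) ≤ Fintype.card V) {w : V → ℝ} (hp : 0 < M.price w) (m : V) (x : ℝ)
    (hq : 0 < M.price (Function.update w m x)) :
    M.supply (Function.update w m x) = M.supply w +
      (M.price w / M.price (Function.update w m x) - 1) •
        deviation M.totalDemand (M.supply w) m := by
  have hx := action_eq_of_update hg hD hn w m x
  ext i
  simp only [Pi.add_apply, Pi.smul_apply, smul_eq_mul, deviation, supply]
  generalize M.price (Function.update w m x) = q at *
  by_cases hi : i = m
  · subst hi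
    rw [Function.update_self, if_pos rfl, hx]
    field_simp
    ring
  · rw [Function.update_of_ne hi, if_neg hi]
    field_simp
    ring

/-- The product of the price and E + S m does not depend on the own action of m. Hence revenue is a
constant minus E times the price. -/
theorem supply_update_self (hg : M.gens = Finset.univ) (hD : 0 < M.totalDemand)
    (hn : (3 : ℝ) ≤ Fintype.card V) {w : V → ℝ} (hp : 0 < M.price w) (m : V) (x : ℝ)
    (hq : 0 < M.price (Function.update w m x)) :
    M.supply (Function.update w m x) m =
      M.price w / M.price (Function.update w m x) *
        ((Fintype.card V - 2) * M.totalDemand + M.supply w m) -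
        (Fintype.card V - 2) * M.totalDemand := by
  rw [supply_update hg hD hn hp m x hq]
  simp only [Pi.add_apply, Pi.smul_apply, smul_eq_mul, deviation, if_true]
  ring

/-- The change in profit when supplier `m` moves the price. -/
theorem profit_update (hg : M.gens = Finset.univ) (hD : 0 < M.totalDemand)
    (hn : (3 : ℝ) ≤ Fintype.card V) {w : V → ℝ} (hp : 0 < M.price w) (m : V) (x : ℝ)
    (hq : 0 < M.price (Function.update w m x)) :
    M.profit (Function.update w m x) m - M.profit w m =
      (Fintype.card V - 2) * M.totalDemand * (M.price w - M.price (Function.update w m x)) -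
      (M.cost m (M.supply (Function.update w m x) m) - M.cost m (M.supply w m)) := by
  simp only [profit]
  have h : M.price (Function.update w m x) * M.supply (Function.update w m x) m =
      M.price w * ((Fintype.card V - 2) * M.totalDemand + M.supply w m) -
        (Fintype.card V - 2) * M.totalDemand * M.price (Function.update w m x) := by
    rw [supply_update_self hg hD hn hp m x hq]
    field_simp
  linarith

end Market

/-! ### The slope γ of the expensive suppliers -/

section WorstSlope

variable {V : Type*} [Fintype V] {G : SimpleGraph V} {v : V} {D σ b : ℝ}

theorem WorstParams.one_lt_worstSlope (h : WorstParams G v D σ b) : 1 < worstSlope V D σ := by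
  have := h.card_mul_σ
  have := h.D_ge
  have := h.three_le'
  have := h.D_le
  have := h.σ_pos
  rw [worstSlope, one_lt_div (by linarith)]
  linarith

theorem worstSlope_mul (h : WorstParams G v D σ b) :
    worstSlope V D σ * ((Fintype.card V - 2) * D + (σ + 1)) =
      (Fintype.card V - 2) * D + (D - (Fintype.card V - 1) * σ - 1) := by
  have := h.D_le
  have := h.D_pos
  have := h.σ_pos
  rw [worstSlope, div_mul_cancel₀]
  linarith

theorem worstMarket_lo_pos (h : WorstParams G v D σ b) :
    0 < D - (Fintype.card V - 1) * σ - 1 := by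
  have := h.card_mul_σ
  have := h.D_ge
  have := h.three_le'
  have := h.σ_pos
  linarith

end WorstSlope

/-! ### Equilibrium supply of the cheap supplier -/

section WorstMarket

variable {V : Type*} [Fintype V] [DecidableEq V] {G : SimpleGraph V} [DecidableRel G.Adj]
  {v : V} {D σ b : ℝ} {k : ℕ}

theorem worstMarket_cost_self (h : WorstParams G v D σ b) {s : ℝ}
    (hs : D - (Fintype.card V - 1) * σ - 1 ≤ s) :
    (worstMarket G v D σ b k).cost v s =
      (D - (Fintype.card V - 1) * σ - 1) / (k + 1) +
        (s - (D - (Fintype.card V - 1) * σ - 1)) := by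
  simp only [worstMarket, if_true]
  exact hockeyCost_of_le (worstMarket_lo_pos h) hs

theorem worstMarket_cost_of_ne {m : V} (hm : m ≠ v) (s : ℝ) :
    (worstMarket G v D σ b k).cost m s = worstSlope V D σ * s := by
  simp only [worstMarket, if_neg hm]

/-- The others share one linear cost, so total cost depends on `s v` alone, with slope 1 - γ. -/
theorem worstMarket_totalCost (h : WorstParams G v D σ b) {s : V → ℝ} (hs : ∑ i, s i = D)
    (hv : D - (Fintype.card V - 1) * σ - 1 ≤ s v) :
    (worstMarket G v D σ b k).totalCost s =
      (D - (Fintype.card V - 1) * σ - 1) / (k + 1) +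
        (s v - (D - (Fintype.card V - 1) * σ - 1)) + worstSlope V D σ * (D - s v) := by
  change ∑ i, (worstMarket G v D σ b k).cost i (s i) = _
  rw [← Finset.add_sum_erase _ _ (Finset.mem_univ v), worstMarket_cost_self h hv,
    Finset.sum_congr rfl fun i hi =>
      worstMarket_cost_of_ne (Finset.ne_of_mem_erase hi) (s i), ← Finset.mul_sum]
  rw [← Finset.add_sum_erase _ _ (Finset.mem_univ v)] at hs
  rw [← hs]
  ring

theorem worstMarket_slo_ge (h : WorstParams G v D σ b) (i : V) :
    σ ≤ (worstMarket G v D σ b k).slo i := by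
  have := h.card_mul_σ
  have := h.D_ge
  have := h.three_le'
  simp only [worstMarket]
  split_ifs
  · linarith
  · exact le_rfl

theorem sum_erase_ge {s : V → ℝ} (v : V) (hlo : ∀ i, i ≠ v → σ ≤ s i) :
    (Fintype.card V - 1) * σ ≤ ∑ i ∈ Finset.univ.erase v, s i := by
  have h4 : (Finset.univ.erase v).card • σ ≤ ∑ i ∈ Finset.univ.erase v, s i :=
    Finset.card_nsmul_le_sum _ _ _ fun i hi => hlo i (Finset.ne_of_mem_erase hi)
  have : 1 ≤ Fintype.card V := Fintype.card_pos_iff.2 ⟨v⟩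
  rwa [nsmul_eq_mul, Finset.card_erase_of_mem (Finset.mem_univ v), Finset.card_univ,
    Nat.cast_sub this, Nat.cast_one] at h4

/-- Within the capacity limits, `v` leaves at least the lower limits to the others. -/
theorem supply_self_le {s : V → ℝ} (hs : ∑ i, s i = D)
    (hlo : ∀ i, (worstMarket G v D σ b k).slo i ≤ s i) :
    s v ≤ D - (Fintype.card V - 1) * σ := by
  have h1 := sum_erase_ge v (σ := σ) (s := s) fun i hi => by
    simpa [worstMarket, hi] using hlo i
  rw [← Finset.add_sum_erase _ _ (Finset.mem_univ v)] at hs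
  linarith

/-- Within the capacity limits, a supplier other than `v` produces at most `σ + 1`. -/
theorem supply_other_le (h : WorstParams G v D σ b) {s : V → ℝ} (hs : ∑ i, s i = D)
    (hlo : ∀ i, (worstMarket G v D σ b k).slo i ≤ s i) {m : V} (hm : m ≠ v) :
    s m ≤ σ + 1 := by
  -- The entry at v is replaced by σ to make the lower bound uniform; its true bound A enters at the
  -- end.
  have h1 : (Fintype.card V - 1) * σ ≤ ∑ i ∈ Finset.univ.erase m, (s i +
      if i = v then σ - s v else 0) := sum_erase_ge m fun i hi => by
    split_ifs with hv
    · subst hv; linarith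
    · simpa [worstMarket, hv] using hlo i
  rw [Finset.sum_add_distrib, Finset.sum_ite_eq', if_pos (by simp [hm.symm])] at h1
  rw [← Finset.add_sum_erase _ _ (Finset.mem_univ m)] at hs
  have := hlo v
  simp only [worstMarket, if_true] at this
  linarith

/-- In equilibrium `v` does not gain by lowering its supply. -/
theorem le_price_of_isSFE (h : WorstParams G v D σ b) {w : V → ℝ}
    (hw : (worstMarket G v D σ b k).IsSFE G w)
    (hlt : D - (Fintype.card V - 1) * σ - 1 < (worstMarket G v D σ b k).supply w v) :
    (Fintype.card V - 2) * D + (worstMarket G v D σ b k).supply w v ≤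
      (worstMarket G v D σ b k).price w * ((Fintype.card V - 2) * D) := by
  set M := worstMarket G v D σ b k with hM
  have hg : M.gens = Finset.univ := rfl
  have hDD : M.totalDemand = D := totalDemand_worstMarket
  have hD : 0 < M.totalDemand := by rw [hDD]; exact h.D_pos
  have hn := h.three_le'
  have hfeas : ∀ i, M.ActionFeasible G w i := fun i => (hw i (by simp [hg])).1
  obtain ⟨-, hp, -, -⟩ := hfeas v
  set p := M.price w with hpdef
  set S := M.supply w with hS
  set A : ℝ := D - (Fintype.card V - 1) * σ - 1 with hA
  set E : ℝ := (Fintype.card V - 2) * D with hE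
  have hApos : 0 < A := worstMarket_lo_pos h
  have hEpos : 0 < E := h.D_pos.trans_le h.D_le
  have hsum : ∑ i, S i = D := by rw [hS, Market.sum_supply hg hD hn hp, hDD]
  have hlo : ∀ i, M.slo i ≤ S i := fun i => (hfeas i).2.2.1.1
  have hSA : A ≤ S v := by
    have := hlo v
    simpa only [hM, worstMarket, if_true] using this
  have hSD := supply_self_le hsum hlo
  have hσ := h.card_mul_σ
  have hσ0 := h.σ_pos
  have hn1 : 0 < ((Fintype.card V : ℝ) - 1) * D := mul_pos (by linarith) h.D_pos
  by_contra! hc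
  -- The first bound on the raised price q makes the gain (q - p) ((E + S v) / q - E) positive; the
  -- second keeps the supply of v at least A.
  obtain ⟨q, hq1, hq2⟩ : ∃ q, p < q ∧ q < min ((E + S v) / E) (p * (E + S v) / (E + A)) := by
    apply exists_between
    rw [lt_min_iff, lt_div_iff₀ hEpos, lt_div_iff₀ (by linarith)]
    exact ⟨hc, by nlinarith⟩
  rw [lt_min_iff, lt_div_iff₀ hEpos, lt_div_iff₀ (by linarith)] at hq2
  have hq0 : 0 < q := hp.trans hq1
  set x := w v + (Fintype.card V - 1) * M.totalDemand * (q - p) with hx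
  have hpx : M.price (Function.update w v x) = q := Market.price_update hg hD hn w v q
  have hSx := Market.supply_update hg hD hn hp v x (by rw [hpx]; exact hq0)
  have hSv := Market.supply_update_self hg hD hn hp v x (by rw [hpx]; exact hq0)
  rw [hpx, hDD] at hSx hSv
  rw [← hE, ← hS, ← hpdef] at hSv
  have hsv : A ≤ M.supply (Function.update w v x) v := by
    rw [hSv, div_mul_eq_mul_div, le_sub_iff_add_le, le_div_iff₀ hq0]
    linarith
  have hsv' : M.supply (Function.update w v x) v ≤ S v := by
    rw [hSv, div_mul_eq_mul_div, sub_le_iff_le_add, div_le_iff₀ hq0]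
    nlinarith
  have hpq : p / q ≤ 1 := (div_le_one hq0).2 hq1.le
  have hlo' : ∀ i, M.slo i ≤ M.supply (Function.update w v x) i := by
    intro i
    by_cases hi : i = v
    · subst hi
      simpa only [hM, worstMarket, if_true] using hsv
    · refine (hlo i).trans ?_
      rw [hSx]
      simp only [Pi.add_apply, Pi.smul_apply, smul_eq_mul, deviation, if_neg hi]
      have h1 : S i ≤ D := by
        have := supply_other_le h hsum hlo hi
        linarith [h.D_ge]
      nlinarith
  have hsum' : ∑ i, M.supply (Function.update w v x) i = D := by
    rw [Market.sum_supply hg hD hn (by rw [hpx]; exact hq0), hDD]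
  have hf : M.ActionFeasible G (Function.update w v x) v := by
    refine ⟨?_, by rw [hpx]; exact hq0, ⟨hlo' v, ?_⟩, flowOK_of_box h hsum' hlo'⟩
    · rw [Function.update_self, hx, hDD]
      have := (hfeas v).1
      nlinarith
    · simp only [hM, worstMarket]
      change M.supply (Function.update w v x) v ≤ 2 * D
      linarith [h.D_pos]
  have hprof := (hw v (by simp [hg])).2 x hf
  have hdiff := Market.profit_update hg hD hn hp v x (by rw [hpx]; exact hq0)
  rw [hpx, hDD, ← hE, ← hS, ← hpdef, worstMarket_cost_self h hsv, worstMarket_cost_self h hSA,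
    hSv] at hdiff
  have h2 : p / q * (E + S v) = (E + S v) - (q - p) * ((E + S v) / q) := by
    field_simp
    ring
  have h3 : E < (E + S v) / q := by
    rw [lt_div_iff₀ hq0]; linarith
  rw [h2] at hdiff
  nlinarith

/-- A supplier other than `v` gains by raising its supply if the price exceeds its perceived
marginal cost. -/
theorem price_le_of_isSFE (h : WorstParams G v D σ b) {w : V → ℝ}
    (hw : (worstMarket G v D σ b k).IsSFE G w) {m : V} (hm : m ≠ v) :
    (worstMarket G v D σ b k).price w * ((Fintype.card V - 2) * D) ≤
      worstSlope V D σ * ((Fintype.card V - 2) * D + (worstMarket G v D σ b k).supply w m) := by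
  set M := worstMarket G v D σ b k with hM
  have hg : M.gens = Finset.univ := rfl
  have hDD : M.totalDemand = D := totalDemand_worstMarket
  have hD : 0 < M.totalDemand := by rw [hDD]; exact h.D_pos
  have hn := h.three_le'
  have hfeas : ∀ i, M.ActionFeasible G w i := fun i => (hw i (by simp [hg])).1
  obtain ⟨-, hp, -, -⟩ := hfeas v
  set p := M.price w with hpdef
  set S := M.supply w with hS
  set A : ℝ := D - (Fintype.card V - 1) * σ - 1 with hA
  set E : ℝ := (Fintype.card V - 2) * D with hE
  have hApos : 0 < A := worstMarket_lo_pos h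
  have hEpos : 0 < E := h.D_pos.trans_le h.D_le
  have hsum : ∑ i, S i = D := by rw [hS, Market.sum_supply hg hD hn hp, hDD]
  have hlo : ∀ i, M.slo i ≤ S i := fun i => (hfeas i).2.2.1.1
  have hSA : A ≤ S v := by
    have := hlo v
    simpa only [hM, worstMarket, if_true] using this
  have hSD := supply_self_le hsum hlo
  have hσ := h.card_mul_σ
  have hσ0 := h.σ_pos
  have hSm := supply_other_le h hsum hlo hm
  have hSmlo : σ ≤ S m := (worstMarket_slo_ge h m).trans (hlo m)
  set γ := worstSlope V D σ with hγdef
  -- Lower the price to q = p / (1 + τ) with small τ > 0. The gain is τ (q E - γ (E + S m)), and the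
  -- action, flow and capacity limits leave room.
  by_contra! hgain
  have hwm : 0 < w m := by
    have h1 : S m = D - w m / p := by rw [hS, ← hDD]; rfl
    have h2 : 0 < w m / p := by linarith [h.D_ge]
    exact (div_pos_iff_of_pos_right hp).1 h2
  have ev : ∀ᶠ τ : ℝ in 𝓝[>] 0, M.FlowOK G (S + τ • deviation D S m) :=
    eventually_flowOK h hsum hlo hm
  have c1 : ∀ᶠ τ : ℝ in 𝓝[>] 0, γ * (E + S m) < p / (1 + τ) * E := by
    have hc : Tendsto (fun τ : ℝ => p / (1 + τ) * E) (𝓝 0) (𝓝 (p / (1 + 0) * E)) :=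
      ((tendsto_const_nhds.div (tendsto_const_nhds.add tendsto_id) (by norm_num)).mul_const E)
    exact (hc.eventually_const_lt (by simpa using hgain)).filter_mono nhdsWithin_le_nhds
  have c2 : ∀ᶠ τ : ℝ in 𝓝[>] 0,
      0 < w m + (Fintype.card V - 1) * D * (p / (1 + τ) - p) := by
    have hc : Tendsto (fun τ : ℝ => w m + (Fintype.card V - 1) * D * (p / (1 + τ) - p)) (𝓝 0)
        (𝓝 (w m + (Fintype.card V - 1) * D * (p / (1 + 0) - p))) :=
      ((((tendsto_const_nhds.div (tendsto_const_nhds.add tendsto_id)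
        (by norm_num)).sub_const p).const_mul _).const_add _)
    exact (hc.eventually_const_lt (by simpa using hwm)).filter_mono nhdsWithin_le_nhds
  have c3 : ∀ᶠ τ : ℝ in 𝓝[>] 0, S m + τ * (E + S m) < 2 * D := by
    have hc : Continuous fun τ : ℝ => S m + τ * (E + S m) := by fun_prop
    refine ((hc.tendsto 0).eventually_lt_const ?_).filter_mono nhdsWithin_le_nhds
    linarith [h.D_ge]
  obtain ⟨τ, hflow, h1, h2, h3, hτ⟩ :=
    (ev.and (c1.and (c2.and (c3.and self_mem_nhdsWithin)))).exists
  have hτ : 0 < τ := hτ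
  set q := p / (1 + τ) with hq
  have hq0 : 0 < q := by positivity
  have hpq : p / q = 1 + τ := by rw [hq]; field_simp
  set x := w m + (Fintype.card V - 1) * M.totalDemand * (q - p) with hx
  have hpx : M.price (Function.update w m x) = q := Market.price_update hg hD hn w m q
  have hSx := Market.supply_update hg hD hn hp m x (by rw [hpx]; exact hq0)
  have hSv := Market.supply_update_self hg hD hn hp m x (by rw [hpx]; exact hq0)
  rw [hpx, hDD, ← hS, ← hpdef, hpq] at hSx hSv
  rw [add_sub_cancel_left] at hSx
  rw [← hE] at hSv
  have hSv' : M.supply (Function.update w m x) m = S m + τ * (E + S m) := by rw [hSv]; ring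
  have hf : M.ActionFeasible G (Function.update w m x) m := by
    refine ⟨?_, by rw [hpx]; exact hq0, ⟨?_, ?_⟩, by rw [hSx]; exact hflow⟩
    · rw [Function.update_self, hx, hDD]; exact h2.le
    · rw [hSv']
      have : 0 ≤ τ * (E + S m) := mul_nonneg hτ.le (by linarith)
      linarith [hlo m]
    · rw [hSv']; exact h3.le
  have hprof := (hw m (by simp [hg])).2 x hf
  have hdiff := Market.profit_update hg hD hn hp m x (by rw [hpx]; exact hq0)
  rw [hpx, hDD, ← hE, ← hS, ← hpdef, worstMarket_cost_of_ne hm, worstMarket_cost_of_ne hm,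
    hSv', ← hγdef] at hdiff
  have hpq' : p - q = τ * q := by
    rw [hq]; field_simp; ring
  rw [hpq'] at hdiff
  have : 0 < τ * (q * E - γ * (E + S m)) := mul_pos hτ (by linarith)
  nlinarith

/-- In equilibrium `v` produces at its lower limit. -/
theorem supply_eq_of_isSFE (h : WorstParams G v D σ b) {w : V → ℝ}
    (hw : (worstMarket G v D σ b k).IsSFE G w) :
    (worstMarket G v D σ b k).supply w v = D - (Fintype.card V - 1) * σ - 1 := by
  set M := worstMarket G v D σ b k with hM
  have hg : M.gens = Finset.univ := rfl
  have hDD : M.totalDemand = D := totalDemand_worstMarket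
  have hD : 0 < M.totalDemand := by rw [hDD]; exact h.D_pos
  have hn := h.three_le'
  have hfeas : ∀ i, M.ActionFeasible G w i := fun i => (hw i (by simp [hg])).1
  obtain ⟨-, hp, -, -⟩ := hfeas v
  set p := M.price w with hpdef
  set S := M.supply w with hS
  set A : ℝ := D - (Fintype.card V - 1) * σ - 1 with hA
  set E : ℝ := (Fintype.card V - 2) * D with hE
  have hApos : 0 < A := worstMarket_lo_pos h
  have hEpos : 0 < E := h.D_pos.trans_le h.D_le
  have hsum : ∑ i, S i = D := by rw [hS, Market.sum_supply hg hD hn hp, hDD]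
  have hlo : ∀ i, M.slo i ≤ S i := fun i => (hfeas i).2.2.1.1
  have hSA : A ≤ S v := by
    have := hlo v
    simpa only [hM, worstMarket, if_true] using this
  have hSD := supply_self_le hsum hlo
  have hσ := h.card_mul_σ
  have hσ0 := h.σ_pos
  by_contra hne
  have hlt : A < S v := lt_of_le_of_ne hSA (Ne.symm hne)
  have hp1 : E + S v ≤ p * E := le_price_of_isSFE h hw hlt
  obtain ⟨m, hm⟩ : ∃ m, m ≠ v := by
    have : Nontrivial V := Fintype.one_lt_card_iff_nontrivial.1 (by have := h.three_le; omega)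
    exact exists_ne v
  have hp2 := price_le_of_isSFE h hw hm
  have hSm := supply_other_le h hsum hlo hm
  have hγ := h.one_lt_worstSlope
  have hγm := worstSlope_mul h
  -- Now E + S v ≤ p E ≤ γ (E + σ + 1) = E + A, against A < S v.
  have h1 : worstSlope V D σ * (E + S m) ≤ worstSlope V D σ * (E + (σ + 1)) := by gcongr
  rw [hγm] at h1
  linarith

end WorstMarket

/-- No profitable deviation for `v` at its lower limit A: only q ≤ p is allowed, and the gain is -(p
- q) ((E + A) / q - E). -/
theorem sub_nonpos_of_price_le {E A p q : ℝ} (hE : 0 < E) (hA : 0 < A) (hq : 0 < q)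
    (hpE : p * E ≤ E + A) (h : E + A ≤ p / q * (E + A)) :
    E * (p - q) - (p / q * (E + A) - E - A) ≤ 0 := by
  have hEA : 0 < E + A := by linarith
  have hqp : q ≤ p := by
    have h1 : 1 ≤ p / q := le_of_mul_le_mul_right (by linarith) hEA
    rwa [one_le_div hq] at h1
  have h1 : E ≤ (E + A) / q := by
    rw [le_div_iff₀ hq]
    have : E * q ≤ E * p := by gcongr
    linarith
  have h2 : p / q * (E + A) = (E + A) + (p - q) * ((E + A) / q) := by
    field_simp; ring
  have h3 := mul_nonneg (sub_nonneg.2 hqp) (sub_nonneg.2 h1)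
  rw [h2]
  linarith

/-- No profitable deviation for a supplier whose perceived marginal cost equals the price: the gain
is -E (p - q)² / q. -/
theorem sub_nonpos_of_price_eq {E y γ p q : ℝ} (hE : 0 < E) (hq : 0 < q)
    (hpE : p * E = γ * (E + y)) :
    E * (p - q) - (γ * (p / q * (E + y) - E) - γ * y) ≤ 0 := by
  have h1 : γ * (p / q * (E + y) - E) - γ * y = p / q * (p * E) - p * E := by
    rw [hpE]; ring
  have h2 : E * (p - q) - (p / q * (p * E) - p * E) = - (E * (p - q) ^ 2 / q) := by
    field_simp; ring
  rw [h1, h2]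
  have : 0 ≤ E * (p - q) ^ 2 / q := by positivity
  linarith

theorem iSup_eq_of_forall_le {ι : Type*} [Finite ι] {F : ι → ℝ} {c : ℝ} (i : ι) (hi : F i = c)
    (hle : ∀ j, F j ≤ c) : ⨆ j, F j = c := by
  have : Nonempty ι := ⟨i⟩
  exact le_antisymm (ciSup_le hle) (hi ▸ le_ciSup (Set.finite_range F).bddAbove i)

/-! ### Admissibility, optimum and existence of equilibrium -/

section WorstMarket

variable {V : Type*} [Fintype V] [DecidableEq V] {G : SimpleGraph V} [DecidableRel G.Adj]
  {v : V} {D σ b : ℝ} {k : ℕ}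

theorem demand_worstMarket_self :
    (worstMarket G v D σ b k).d v = D - (Fintype.card V - 1) * σ - G.degree v := by
  have h : lap G (fun e => if v ∈ e then 1 else b) (Pi.single v 1) v = G.degree v := by
    rw [lap_apply, ← SimpleGraph.card_neighborFinset_eq_degree, Finset.card_eq_sum_ones]
    push_cast
    refine Finset.sum_congr rfl fun j hj => ?_
    have hj : v ≠ j := G.ne_of_adj ((G.mem_neighborFinset v j).1 hj)
    simp [Pi.single_eq_of_ne hj.symm]
  simp [worstMarket, baseSupply, h]

theorem demand_worstMarket_of_ne {i : V} (hi : i ≠ v) :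
    σ ≤ (worstMarket G v D σ b k).d i ∧ (worstMarket G v D σ b k).d i ≤ σ + 1 := by
  have h : lap G (fun e => if v ∈ e then 1 else b) (Pi.single v 1) i =
      if v ∈ G.neighborFinset i then -1 else 0 := by
    rw [lap_apply, ← Finset.sum_ite_eq' (G.neighborFinset i) v fun _ => (-1 : ℝ)]
    refine Finset.sum_congr rfl fun j hj => ?_
    rw [Pi.single_eq_of_ne hi]
    by_cases hjv : j = v
    · subst hjv; simp
    · simp [hjv]
  simp only [worstMarket, baseSupply, if_neg hi, h]
  split_ifs <;> constructor <;> linarith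

theorem isAdmissible_worstMarket (h : WorstParams G v D σ b) :
    (worstMarket G v D σ b k).IsAdmissible G := by
  have hn := h.three_le'
  have hσ := h.card_mul_σ
  have hσ0 := h.σ_pos
  have hD := h.D_ge
  have hγ := h.one_lt_worstSlope
  have hA := worstMarket_lo_pos h
  refine
    { demand_nonneg := ?_
      totalDemand_pos := by rw [totalDemand_worstMarket]; exact h.D_pos
      two_lt_card := h.three_le
      cost_zero := ?_
      cost_convex := ?_
      cost_strictMono := ?_
      cost_differentiable := ?_
      slo_nonneg := fun i _ => hσ0.le.trans (worstMarket_slo_ge h i)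
      admittance_pos := fun e _ => h.admittance_pos e
      flowLimit_nonneg := ?_
      dispensable := ?_
      strictly_feasible := ?_ }
  · intro i
    by_cases hi : i = v
    · subst hi
      rw [demand_worstMarket_self]
      have := WorstParams.degree_le (G := G) (v := i)
      linarith
    · exact hσ0.le.trans (demand_worstMarket_of_ne hi).1
  · intro i _
    by_cases hi : i = v
    · simp [worstMarket, hi, hockeyCost_zero]
    · rw [worstMarket_cost_of_ne hi, mul_zero]
  · intro i _
    by_cases hi : i = v
    · simp only [worstMarket, hi, if_true]
      exact (convexOn_hockeyCost hA).subset (Set.subset_univ _) (convex_Ici 0)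
    · simp only [worstMarket, hi, if_false]
      exact (LinearMap.mul ℝ ℝ (worstSlope V D σ)).convexOn (convex_Ici 0)
  · intro i _
    by_cases hi : i = v
    · simp only [worstMarket, hi, if_true]
      exact strictMonoOn_hockeyCost hA
    · simp only [worstMarket, hi, if_false]
      exact (strictMono_mul_left_of_pos (by linarith)).strictMonoOn _
  · intro i _
    by_cases hi : i = v
    · simp only [worstMarket, hi, if_true]
      exact fun s _ => (hasDerivAt_hockeyCost s).differentiableAt.differentiableWithinAt
    · simp only [worstMarket, hi, if_false]
      exact (differentiable_id.const_mul _).differentiableOn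
  · intro e _
    simp only [worstMarket]
    split_ifs <;> norm_num
  · intro i _
    rw [totalDemand_worstMarket]
    simp only [worstMarket, Finset.sum_const, nsmul_eq_mul,
      Finset.card_erase_of_mem (Finset.mem_univ i), Finset.card_univ]
    rw [Nat.cast_sub (by have := h.three_le; omega)]
    push_cast
    nlinarith [h.D_pos]
  -- With this δ, half of the free unit moves from v to the others, which puts every constraint in
  -- its interior.
  · set δ : ℝ := 1 / (2 * (Fintype.card V - 1)) with hδ
    have hδ0 : 0 < δ := by
      rw [hδ]
      exact one_div_pos.2 (by linarith)
    have hδ1 : ((Fintype.card V : ℝ) - 1) * δ = 1 / 2 := by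
      have : (Fintype.card V : ℝ) - 1 ≠ 0 := by linarith
      rw [hδ]; field_simp
    have hδ2 : δ ≤ 1 / 2 := by nlinarith
    have hs : ∑ i, baseSupply v D (σ + δ) i = D := sum_baseSupply v D (σ + δ)
    have hlo : ∀ i, (worstMarket G v D σ b k).slo i < baseSupply v D (σ + δ) i := by
      intro i
      simp only [worstMarket, baseSupply]
      split_ifs <;> linarith
    refine ⟨baseSupply v D (σ + δ), by rw [totalDemand_worstMarket]; exact hs, fun i _ =>
      ⟨hlo i, ?_⟩, flowStrict_of_box h hs (fun i => (hlo i).le) ?_⟩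
    · simp only [worstMarket, baseSupply]
      split_ifs <;> linarith
    · simp only [baseSupply, if_true]
      linarith

/-- Total cost decreases in the supply of `v`, and this profile gives `v` all that the others' lower
limits leave. -/
theorem isSocialOptimum_baseSupply (h : WorstParams G v D σ b) :
    (worstMarket G v D σ b k).IsSocialOptimum G (baseSupply v D σ) := by
  have hn := h.three_le'
  have hσ := h.card_mul_σ
  have hσ0 := h.σ_pos
  have hD := h.D_ge
  have hγ := h.one_lt_worstSlope
  have hs := sum_baseSupply v D σ
  have hlo : ∀ i, (worstMarket G v D σ b k).slo i ≤ baseSupply v D σ i := by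
    intro i
    simp only [worstMarket, baseSupply]
    split_ifs <;> linarith
  refine ⟨⟨by rw [totalDemand_worstMarket]; exact hs, fun i _ => ⟨hlo i, ?_⟩,
    flowOK_of_box h hs hlo⟩, ?_⟩
  · simp only [worstMarket, baseSupply]
    split_ifs <;> linarith
  · rintro s ⟨hs', hcap, -⟩
    rw [totalDemand_worstMarket] at hs'
    have hlo' : ∀ i, (worstMarket G v D σ b k).slo i ≤ s i := fun i =>
      (hcap i (Finset.mem_univ i)).1
    have h1 := supply_self_le hs' hlo'
    have h2 := hlo' v
    have h3 : baseSupply v D σ v = D - (Fintype.card V - 1) * σ := by simp [baseSupply]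
    simp only [worstMarket, if_true] at h2
    rw [worstMarket_totalCost h hs (by rw [h3]; linarith), worstMarket_totalCost h hs' h2, h3]
    nlinarith

theorem totalCost_of_isSocialOptimum (h : WorstParams G v D σ b) {s : V → ℝ}
    (hs : (worstMarket G v D σ b k).IsSocialOptimum G s) :
    (worstMarket G v D σ b k).totalCost s =
      (D - (Fintype.card V - 1) * σ - 1) / (k + 1) + 1 +
        worstSlope V D σ * ((Fintype.card V - 1) * σ) := by
  have hb := isSocialOptimum_baseSupply (k := k) h
  rw [le_antisymm (hs.2 _ hb.1) (hb.2 _ hs.1),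
    worstMarket_totalCost h (sum_baseSupply v D σ) (by simp [baseSupply])]
  simp only [baseSupply, if_true]
  ring

theorem totalCost_of_isSFE (h : WorstParams G v D σ b) {w : V → ℝ}
    (hw : (worstMarket G v D σ b k).IsSFE G w) :
    (worstMarket G v D σ b k).totalCost ((worstMarket G v D σ b k).supply w) =
      (D - (Fintype.card V - 1) * σ - 1) / (k + 1) +
        worstSlope V D σ * ((Fintype.card V - 1) * σ + 1) := by
  have hsum : ∑ i, (worstMarket G v D σ b k).supply w i = D := by
    rw [Market.sum_supply rfl (by rw [totalDemand_worstMarket]; exact h.D_pos) h.three_le'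
      (hw v (Finset.mem_univ v)).1.2.1, totalDemand_worstMarket]
  have hv := supply_eq_of_isSFE h hw
  rw [worstMarket_totalCost h hsum hv.ge, hv]
  ring

/-- Let `v` produce A and the others share the free unit equally, at y = σ + 1 / (N - 1) each, and
let the price be their perceived marginal cost γ (1 + y / E). Since y ≤ σ + 1, this price is at most
1 + A / E, so `v` does not want to expand. -/
theorem exists_isSFE (h : WorstParams G v D σ b) :
    ∃ w, (worstMarket G v D σ b k).IsSFE G w := by
  set M := worstMarket G v D σ b k with hM
  have hg : M.gens = Finset.univ := rfl
  have hDD : M.totalDemand = D := totalDemand_worstMarket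
  have hD : 0 < M.totalDemand := by rw [hDD]; exact h.D_pos
  have hD0 := h.D_pos
  have hn := h.three_le'
  have hσ := h.card_mul_σ
  have hσ0 := h.σ_pos
  have hDge := h.D_ge
  have hγ1 := h.one_lt_worstSlope
  have hγm := worstSlope_mul h
  set γ := worstSlope V D σ with hγdef
  set A : ℝ := D - (Fintype.card V - 1) * σ - 1 with hA
  set E : ℝ := (Fintype.card V - 2) * D with hE
  have hApos : 0 < A := worstMarket_lo_pos h
  have hEpos : 0 < E := h.D_pos.trans_le h.D_le
  have hn1 : (0 : ℝ) < Fintype.card V - 1 := by linarith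
  set y : ℝ := σ + 1 / (Fintype.card V - 1) with hy
  have hy1 : σ ≤ y := by
    have : 0 < 1 / ((Fintype.card V : ℝ) - 1) := one_div_pos.2 hn1
    linarith
  have hy2 : y ≤ σ + 1 := by
    have : 1 / ((Fintype.card V : ℝ) - 1) ≤ 1 := by
      rw [div_le_one hn1]; linarith
    linarith
  set S : V → ℝ := baseSupply v D y with hS
  have hSv : S v = A := by
    simp only [hS, baseSupply, if_true, hy, hA]
    field_simp
    ring
  have hSm : ∀ i, i ≠ v → S i = y := fun i hi => by simp only [hS, baseSupply, if_neg hi]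
  have hsum : ∑ i, S i = D := sum_baseSupply v D y
  have hSD : ∀ i, S i ≤ D := by
    intro i
    by_cases hi : i = v
    · rw [hi, hSv]; linarith
    · rw [hSm i hi]; linarith
  have hlo : ∀ i, M.slo i ≤ S i := by
    intro i
    by_cases hi : i = v
    · rw [hi, hSv]; simp only [hM, worstMarket, if_true]; exact le_rfl
    · rw [hSm i hi]; simpa only [hM, worstMarket, if_neg hi] using hy1
  set p : ℝ := γ * (E + y) / E with hp
  have hp0 : 0 < p := by positivity
  have hpE : p * E = γ * (E + y) := by rw [hp]; field_simp
  -- The bids at which price p yields the supplies S.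
  set w : V → ℝ := fun i => p * (D - S i) with hw
  have hprice : M.price w = p := by
    have h1 := Market.sum_actions hg hD hn w
    have h2 : ∑ i, w i = (Fintype.card V - 1) * D * p := by
      simp only [hw, ← Finset.mul_sum, Finset.sum_sub_distrib, hsum, Finset.sum_const,
        Finset.card_univ, nsmul_eq_mul]
      ring
    rw [h2, hDD] at h1
    exact (mul_left_cancel₀ (mul_pos hn1 hD0).ne' h1).symm
  have hsup : M.supply w = S := by
    ext i
    rw [Market.supply, hprice, hDD]
    change D - p * (D - S i) / p = S i
    rw [mul_div_cancel_left₀ _ hp0.ne', sub_sub_cancel]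
  refine ⟨w, fun m _ => ⟨⟨mul_nonneg hp0.le (by linarith [hSD m]), by rwa [hprice],
    ⟨by rw [hsup]; exact hlo m, ?_⟩, by rw [hsup]; exact flowOK_of_box h hsum hlo⟩, ?_⟩⟩
  · rw [hsup]
    change S m ≤ 2 * D
    linarith [hSD m]
  · intro x hx
    obtain ⟨-, hq, ⟨hx1, -⟩, -⟩ := hx
    have hdiff := Market.profit_update hg hD hn (by rwa [hprice]) m x hq
    have hSx := Market.supply_update_self hg hD hn (by rwa [hprice]) m x hq
    rw [hDD, hprice, hsup, ← hE] at hdiff hSx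
    generalize M.price (Function.update w m x) = q at *
    generalize M.supply (Function.update w m x) m = s' at *
    by_cases hm : m = v
    · subst hm
      rw [hSv] at hdiff hSx
      have hA' : A ≤ s' := by simpa only [hM, worstMarket, if_true] using hx1
      rw [worstMarket_cost_self h hA', worstMarket_cost_self h le_rfl, hSx] at hdiff
      have hpA : p * E ≤ E + A := by
        rw [hpE, ← hγm]; gcongr
      have h1 := sub_nonpos_of_price_le hEpos hApos hq hpA (by linarith)
      linarith
    · rw [worstMarket_cost_of_ne hm, worstMarket_cost_of_ne hm, hSx, hSm m hm, ← hγdef] at hdiff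
      have h1 := sub_nonpos_of_price_eq hEpos hq hpE
      linarith

theorem isPoA_worstMarket (h : WorstParams G v D σ b) :
    (worstMarket G v D σ b k).IsPoA G
      (((D - (Fintype.card V - 1) * σ - 1) / (k + 1) +
          worstSlope V D σ * ((Fintype.card V - 1) * σ + 1)) /
        ((D - (Fintype.card V - 1) * σ - 1) / (k + 1) + 1 +
          worstSlope V D σ * ((Fintype.card V - 1) * σ))) :=
  ⟨exists_isSFE h, ⟨_, isSocialOptimum_baseSupply h⟩, fun w s hw hs => by
    rw [totalCost_of_isSFE h hw, totalCost_of_isSocialOptimum h hs]⟩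

/-! ### The bound and its distance from the price of anarchy -/

/-- These crude bounds hold for every partition and suffice, since effective flows at `v` sum to at
most N, which is negligible against D. -/
theorem effFlow_worstMarket (h : WorstParams G v D σ b) (P : NeighborPartition G) (n m : V) :
    0 ≤ (worstMarket G v D σ b k).effFlow P n m ∧
      (worstMarket G v D σ b k).effFlow P n m ≤ (worstMarket G v D σ b k).f s(n, m) := by
  have hf : ∀ e, 0 ≤ (worstMarket G v D σ b k).f e := by
    intro e
    simp only [worstMarket]
    split_ifs <;> norm_num
  have hB : ∀ e, 0 ≤ (worstMarket G v D σ b k).B e := fun e => (h.admittance_pos e).le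
  unfold Market.effFlow
  split_ifs
  · exact ⟨hf _, le_rfl⟩
  · exact ⟨le_min (hf _) (mul_nonneg (Finset.sum_nonneg fun e _ => div_nonneg (hf e) (hB e))
      (hB _)), min_le_left _ _⟩

theorem networkTerm_worstMarket_self (h : WorstParams G v D σ b) (P : NeighborPartition G) :
    D - (Fintype.card V - 1) * σ - Fintype.card V ≤ (worstMarket G v D σ b k).networkTerm P v ∧
      (worstMarket G v D σ b k).networkTerm P v ≤ D - (Fintype.card V - 1) * σ := by
  have h1 : 0 ≤ ∑ m ∈ G.neighborFinset v, (worstMarket G v D σ b k).effFlow P v m :=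
    Finset.sum_nonneg fun m _ => (effFlow_worstMarket h P v m).1
  have h2 : ∑ m ∈ G.neighborFinset v, (worstMarket G v D σ b k).effFlow P v m ≤
      (G.neighborFinset v).card • (1 : ℝ) :=
    Finset.sum_le_card_nsmul _ _ _ fun m _ =>
      (effFlow_worstMarket h P v m).2.trans (by simp [worstMarket])
  have h3 := WorstParams.degree_le (G := G) (v := v)
  rw [SimpleGraph.card_neighborFinset_eq_degree, nsmul_eq_mul, mul_one] at h2
  rw [Market.networkTerm, demand_worstMarket_self]
  constructor <;> linarith

theorem networkTerm_worstMarket_le (h : WorstParams G v D σ b) (P : NeighborPartition G) (n : V) :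
    (worstMarket G v D σ b k).networkTerm P n ≤
      (worstMarket G v D σ b k).networkTerm P v := by
  by_cases hn : n = v
  · rw [hn]
  · have h2 : ∑ m ∈ G.neighborFinset n, (worstMarket G v D σ b k).effFlow P n m ≤
        (G.neighborFinset n).card • (3 : ℝ) :=
      Finset.sum_le_card_nsmul _ _ _ fun m _ =>
        (effFlow_worstMarket h P n m).2.trans (by
          simp only [worstMarket]
          split_ifs <;> norm_num)
    have h3 := WorstParams.degree_le (G := G) (v := n)
    rw [SimpleGraph.card_neighborFinset_eq_degree, nsmul_eq_mul] at h2
    refine le_trans ?_ (networkTerm_worstMarket_self h P).1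
    have h4 := (demand_worstMarket_of_ne (G := G) (D := D) (σ := σ) (b := b) (k := k) hn).2
    have := h.D_ge
    have := h.three_le'
    have := h.card_mul_σ
    have := h.σ_pos
    rw [Market.networkTerm]
    linarith

/-- Unit line limits at `v` keep its network term below D minus the others' lower limits, so the
minimum is the network term; `v` attains the maximum because it holds most demand. -/
theorem bound_worstMarket (h : WorstParams G v D σ b) (P : NeighborPartition G) :
    (worstMarket G v D σ b k).bound P =
        1 + (worstMarket G v D σ b k).networkTerm P v / ((Fintype.card V - 2) * D) ∧
      (worstMarket G v D σ b k).networkBound P =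
        1 + (worstMarket G v D σ b k).networkTerm P v / ((Fintype.card V - 2) * D) := by
  have hE : 0 < ((Fintype.card V : ℝ) - 2) * D := h.D_pos.trans_le h.D_le
  have hcard : ((worstMarket G v D σ b k).gens.card : ℝ) = Fintype.card V := rfl
  rw [Market.bound, Market.networkBound, totalDemand_worstMarket, hcard]
  have hNT := networkTerm_worstMarket_self (k := k) h P
  have hσ := h.card_mul_σ
  constructor
  · congr 1
    refine iSup_eq_of_forall_le ⟨v, Finset.mem_univ v⟩ ?_ ?_
    · congr 1
      have hslo : ∑ m ∈ (worstMarket G v D σ b k).gens.erase v,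
          (worstMarket G v D σ b k).slo m = (Fintype.card V - 1) * σ := by
        rw [Finset.sum_congr rfl fun m hm => show (worstMarket G v D σ b k).slo m = σ by
          simp only [worstMarket, if_neg (Finset.ne_of_mem_erase hm)]]
        rw [Finset.sum_const, show (worstMarket G v D σ b k).gens = Finset.univ from rfl,
          Finset.card_erase_of_mem (Finset.mem_univ v), nsmul_eq_mul]
        have : 1 ≤ Fintype.card V := Fintype.card_pos_iff.2 ⟨v⟩
        change ((Fintype.card V - 1 : ℕ) : ℝ) * σ = _
        rw [Nat.cast_sub this, Nat.cast_one]
      rw [hslo, min_eq_right hNT.2, min_eq_right]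
      change _ ≤ 2 * D
      linarith [h.D_pos]
    · intro n
      gcongr
      exact ((min_le_right _ _).trans (min_le_right _ _)).trans
        (networkTerm_worstMarket_le h P n)
  · congr 1
    refine iSup_eq_of_forall_le ⟨v, Finset.mem_univ v⟩ rfl fun n => ?_
    gcongr
    exact networkTerm_worstMarket_le h P n

/-- The price of anarchy of `worstMarket` is close to the bound when `D` is large and `σ` and the
cost of the first units of `v` are small. -/
theorem abs_poA_sub_bound_le (h : WorstParams G v D σ b) (P : NeighborPartition G) {ε : ℝ}
    (hD : 20 * Fintype.card V ≤ ε * D) (hσ : 8 * (Fintype.card V * σ) ≤ ε)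
    (hk : (D - (Fintype.card V - 1) * σ - 1) / (k + 1) ≤ ε / 4) :
    |((D - (Fintype.card V - 1) * σ - 1) / (k + 1) +
          worstSlope V D σ * ((Fintype.card V - 1) * σ + 1)) /
        ((D - (Fintype.card V - 1) * σ - 1) / (k + 1) + 1 +
          worstSlope V D σ * ((Fintype.card V - 1) * σ)) -
      (worstMarket G v D σ b k).bound P| ≤ ε := by
  rw [(bound_worstMarket h P).1]
  obtain ⟨hT1, hT2⟩ := networkTerm_worstMarket_self (k := k) h P
  set T := (worstMarket G v D σ b k).networkTerm P v
  have hn := h.three_le'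
  have hσ0 := h.σ_pos
  have hz := h.card_mul_σ
  have hDE := h.D_le
  have hD0 := h.D_pos
  have hDge := h.D_ge
  have hA := worstMarket_lo_pos h
  have hγ1 := h.one_lt_worstSlope
  have hγm := worstSlope_mul h
  have hc0 : 0 ≤ (D - (Fintype.card V - 1) * σ - 1) / ((k : ℝ) + 1) :=
    div_nonneg hA.le (by positivity)
  have hzn : ((Fintype.card V : ℝ) - 1) * σ ≤ Fintype.card V * σ := by nlinarith
  set c := (D - (Fintype.card V - 1) * σ - 1) / ((k : ℝ) + 1)
  set z := ((Fintype.card V : ℝ) - 1) * σ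
  set E := ((Fintype.card V : ℝ) - 2) * D
  set γ := worstSlope V D σ
  set n : ℝ := (Fintype.card V : ℝ)
  have hE0 : 0 < E := hD0.trans_le hDE
  -- Since A ≤ D ≤ E, the numerator of γ is at most 2 E.
  have hγ2 : γ ≤ 2 := by
    by_contra! hc
    nlinarith
  have hden : 0 < c + 1 + γ * z := by nlinarith
  have hε : 0 < ε := by nlinarith
  -- the ratio of the costs is close to the slope
  have h1 : |(c + γ * (z + 1)) / (c + 1 + γ * z) - γ| ≤ ε / 2 := by
    have h2 : (c + γ * (z + 1)) / (c + 1 + γ * z) - γ =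
        - ((c + γ * z) * (γ - 1) / (c + 1 + γ * z)) := by
      field_simp; ring
    have h3 : 0 ≤ (c + γ * z) * (γ - 1) := mul_nonneg (by nlinarith) (by linarith)
    rw [h2, abs_neg, abs_of_nonneg (div_nonneg h3 hden.le), div_le_iff₀ hden]
    have h4 : c + γ * z ≤ ε / 2 := by nlinarith
    have h5 : 0 ≤ γ * z := by nlinarith
    nlinarith
  -- the slope is close to the bound
  have h2 : |γ - (1 + T / E)| ≤ ε / 2 := by
    have h3 : γ - (1 + T / E) = ((γ - 1) * E - T) / E := by
      field_simp; ring
    rw [h3, abs_div, abs_of_pos hE0, div_le_iff₀ hE0]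
    -- This is D - z up to a bounded error, and T is D - z up to N; the assumption ε D ≥ 20 N
    -- absorbs both.
    have h4 : (γ - 1) * E = D - z - 1 - (σ + 1) - (γ - 1) * (σ + 1) := by linarith
    have hσ1 := h.σ_le_one
    have h5 : 0 ≤ (γ - 1) * (σ + 1) := mul_nonneg (by linarith) (by linarith)
    have h6 : (γ - 1) * (σ + 1) ≤ 2 := by nlinarith
    have h7 : ε * D ≤ ε * E := by gcongr
    rw [h4]
    refine abs_le.2 ⟨by linarith, by linarith⟩
  have h3 := abs_sub_le ((c + γ * (z + 1)) / (c + 1 + γ * z)) γ (1 + T / E)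
  linarith

end WorstMarket

theorem exists_worstParams {V : Type*} [Fintype V] (G : SimpleGraph V) (hconn : G.Connected)
    (hcard : 3 ≤ Fintype.card V) {ε : ℝ} (hε : 0 < ε) :
    ∃ (v : V) (D σ b : ℝ), WorstParams G v D σ b ∧ 20 * Fintype.card V ≤ ε * D ∧
      8 * (Fintype.card V * σ) ≤ ε := by
  have : Nontrivial V := Fintype.one_lt_card_iff_nontrivial.1 (by omega)
  -- Every finite connected graph with at least two nodes has a non-cut node.
  obtain ⟨v, hv⟩ := hconn.exists_connected_induce_compl_singleton_of_finite_nontrivial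
  have hn : (0 : ℝ) < Fintype.card V := by exact_mod_cast (by omega : 0 < Fintype.card V)
  set n : ℝ := (Fintype.card V : ℝ) with hndef
  set σ : ℝ := min 1 (ε / 8) / n with hσ
  have hσ0 : 0 < σ := by positivity
  have hnσ : n * σ = min 1 (ε / 8) := by rw [hσ]; field_simp
  set D : ℝ := max (10 * n) (20 * n / ε) with hD
  refine ⟨v, D, σ, max (4 * n ^ 2) (2 * n ^ 3 * D / σ),
    ⟨hconn, hv, hcard, hσ0, ?_, le_max_left _ _, le_max_left _ _, le_max_right _ _⟩, ?_, ?_⟩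
  · rw [hnσ]; exact min_le_left _ _
  · have := (div_le_iff₀ hε).1 (le_max_right (10 * n) (20 * n / ε))
    linarith
  · rw [hnσ]
    linarith [min_le_right 1 (ε / 8)]

end PowerMarket

theorem theorem2 {V : Type*} [Fintype V] [DecidableEq V] (G : SimpleGraph V) [DecidableRel G.Adj]
    (hconn : G.Connected) (hcard : 3 ≤ Fintype.card V) (hG : PowerMarket.IsWeaklyCyclic G)
    (ε : ℝ) (hε : 0 < ε) :
    Nonempty (PowerMarket.NeighborPartition G) ∧
    ∃ M : PowerMarket.Market V, M.IsAdmissible G ∧ ∃ ρ : ℝ, M.IsPoA G ρ ∧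
      ∀ P : PowerMarket.NeighborPartition G,
        M.bound P = M.networkBound P ∧ |ρ - M.bound P| ≤ ε := by
  refine ⟨hG.nonempty_neighborPartition, ?_⟩
  obtain ⟨v, D, σ, b, h, hD, hσ⟩ := PowerMarket.exists_worstParams G hconn hcard hε
  obtain ⟨k, hk⟩ := exists_nat_gt ((D - (Fintype.card V - 1) * σ - 1) / (ε / 4))
  have hk' : (D - (Fintype.card V - 1) * σ - 1) / ((k : ℝ) + 1) ≤ ε / 4 := by
    rw [div_lt_iff₀ (by linarith)] at hk
    rw [div_le_iff₀ (by positivity)]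
    linarith
  exact ⟨PowerMarket.worstMarket G v D σ b k, PowerMarket.isAdmissible_worstMarket h, _,
    PowerMarket.isPoA_worstMarket h, fun P =>
      ⟨(PowerMarket.bound_worstMarket h P).1.trans (PowerMarket.bound_worstMarket h P).2.symm,
        PowerMarket.abs_poA_sub_bound_le h P hD hσ hk'⟩⟩
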